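/- For every finite monoid $M$ and every odd integer $g\ge 7$ there exist infinitely many pairwise non-isomorphic finite simple undirected graphs $G$ such that $G$ is regular (all vertices have the same degree), $G$ has odd girth $g$ (its shortest odd cycle has length $g$), and the endomorphism monoid $\mathrm{End}(G)$ (all graph homomorphisms $G\to G$, under composition) is isomorphic to $M$. -/

import Mathlib

namespace SimpleGraph

/-- The odd girth of a simple graph: the length of its shortest odd cycle
(`⊤` if the graph has no odd cycle). -/
noncomputable def oddGirth {V : Type*} (G : SimpleGraph V) : ℕ∞ :=
  ⨅ a, ⨅ w : G.Walk a a, ⨅ _ : w.IsCycle ∧ Odd w.length, (w.length : ℕ∞)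

open Classical in
/-- A finite simple graph is regular if all its vertices have the same degree. -/
def IsRegular {V : Type*} [Fintype V] (G : SimpleGraph V) : Prop :=
  ∃ d : ℕ, G.IsRegularOfDegree d

end SimpleGraph

/-!
Write `g = 2 * k + 1` with `3 ≤ k`. The folded cube `Cube k` is the elementary abelian `2`-group
on `g` generators `gen i` with the single further relation that all generators add up to `0`. If
the vertices of a graph are coloured by `Cube k` so that each edge changes the colour by a
generator, then an odd walk between vertices of the same colour uses every generator an odd number
of times, so it has length at least `g` (`le_length_of_odd`). All graphs below are coloured in
this way.

Rigid core. A `Scaffold` consists of a connected cover of the folded cube, the core, and of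
further vertices attached to it, each of which has all its neighbours in a single colour class.
Two neighbours of a core vertex are joined by a walk of length `g - 2`, so their images under an
endomorphism have different colours. Hence endomorphisms map the core to itself, locally
bijectively, and thus bijectively (`coreMap_injective`); one that preserves the fibres and fixes a
core vertex fixes the core (`coreMap_eq_self`). Attached vertices of large degree are mapped to
attached vertices.

Regular graphs from patterns. A `Pattern` is a bipartite graph with labelled vertices. One copy of
it for every colour is attached to the core: vertices of the first side to one fibre and those of
the second side to the fibre that differs by `gen none`. In a single copy, vertices with the same
label have the same neighbours in the core; in all other copies, different vertices have disjoint
neighbourhoods there. Two leaves `a` and `b` are an exception: the number of their common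
neighbours is positive and depends on the fibre, is `1` for one fibre, and no other two different
neighbourhoods of pattern vertices in the core intersect. This forces endomorphisms to preserve
the fibres and to fix a core vertex, so they fix the core. Pads, which are vertices adjacent to
the core only, supply the missing degrees and connect the fibres (`exists_pads`). In the end an
endomorphism can only move the vertices of one copy of the pattern, preserving labels
(`Pattern.Choices.endEquiv`).

Monoids. The pattern of a monoid `M` contains two copies `s`, `t` of `M`, and a vertex `β (x, y,
d)` next to `s x` and `t y` for all `x`, `y`, `d`, with a label that remembers `d`. This vertex is
adjacent to a constant `c` exactly if `x * d = y`. So a label-preserving endomorphism acts on `s`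
and on `t` by the same map, which commutes with right multiplications and is therefore a left
multiplication. Further vertices keep the degrees constant on labels; a triple with `x * d ≠ y`
may be mapped to one with `x * d = y`, and then they are folded (`MonoidPattern.labelEndEquiv`).

The degree of the regular graph can be chosen in infinitely many ways, which gives pairwise
non-isomorphic graphs.
-/

/-! ### The folded cube and odd walks -/

namespace MonoidGraph

open SimpleGraph

/-- The `2 * k + 1` directions of the folded cube: `k` pairs of directions `some (m, b)` and one
unpaired direction `none`. -/
abbrev Dir (k : ℕ) := Option (Fin k × Bool)

/-- The vertex set of the folded cube of dimension `2 * k`, as the elementary abelian `2`-group on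
the directions modulo the all-ones vector. -/
abbrev Cube (k : ℕ) := (Dir k → ZMod 2) ⧸ AddSubgroup.zmultiples (1 : Dir k → ZMod 2)

instance (k : ℕ) : Finite (Cube k) := Quotient.finite _

noncomputable instance (k : ℕ) : Fintype (Cube k) := Fintype.ofFinite _

noncomputable instance (k : ℕ) : DecidableEq (Cube k) := Classical.decEq _

/-- The generator of the folded cube in direction `i`. -/
def gen {k : ℕ} (i : Dir k) : Cube k := QuotientAddGroup.mk (Pi.single i 1)

variable {k : ℕ}

lemma card_dir : Fintype.card (Dir k) = 2 * k + 1 := by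
  simp [Dir, mul_comm]

lemma cube_add_self (u : Cube k) : u + u = 0 := by
  induction u using QuotientAddGroup.induction_on with
  | H v =>
    rw [← QuotientAddGroup.mk_add, QuotientAddGroup.eq_zero_iff]
    have : v + v = 0 := by ext i; exact CharTwo.add_self_eq_zero _
    rw [this]; exact zero_mem _

lemma cube_add_add_self (u v : Cube k) : u + v + v = u := by
  rw [add_assoc, cube_add_self, add_zero]

lemma sum_smul_gen (n : Dir k → ℕ) :
    ∑ i, n i • gen i = (QuotientAddGroup.mk (fun i => (n i : ZMod 2)) : Cube k) := by
  have : (fun i => (n i : ZMod 2)) = ∑ i, n i • (Pi.single i 1 : Dir k → ZMod 2) := by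
    ext j
    simp [Finset.sum_apply, Pi.single_apply]
  rw [this]
  simp only [gen]
  rw [← QuotientAddGroup.mk'_apply, map_sum]
  simp

/-- The only relations between the generators of the folded cube are those forced by
`2 • gen i = 0` and `∑ i, gen i = 0`. -/
lemma parity_of_sum_smul_gen_eq_zero {n : Dir k → ℕ} (h : ∑ i, n i • gen i = (0 : Cube k)) :
    (∀ i, Even (n i)) ∨ ∀ i, Odd (n i) := by
  rw [sum_smul_gen, QuotientAddGroup.eq_zero_iff, AddSubgroup.mem_zmultiples_iff] at h
  obtain ⟨z, hz⟩ := h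
  have hz' : ∀ i, (n i : ZMod 2) = (z : ZMod 2) := by
    intro i
    have := congrFun hz i
    simpa using this.symm
  rcases Int.even_or_odd z with hz | hz
  · left
    intro i
    have h1 := hz' i
    rw [(ZMod.intCast_zmod_eq_zero_iff_dvd z 2).2 (by exact_mod_cast hz.two_dvd)] at h1
    exact even_iff_two_dvd.2 ((ZMod.natCast_eq_zero_iff _ _).1 h1)
  · right
    intro i
    have h1 := hz' i
    rw [ZMod.intCast_eq_one_iff_odd.2 hz] at h1
    exact ZMod.natCast_eq_one_iff_odd.1 h1

lemma sum_gen : ∑ i : Dir k, gen i = (0 : Cube k) := by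
  have := sum_smul_gen (k := k) (fun _ => 1)
  simp only [one_smul] at this
  rw [this, QuotientAddGroup.eq_zero_iff]
  exact AddSubgroup.mem_zmultiples_iff.2 ⟨1, by ext; simp⟩

lemma eq_of_cube_add_eq_zero {u v : Cube k} (h : u + v = 0) : u = v := by
  rw [← cube_add_add_self u v, h, zero_add]

lemma gen_injective (hk : 1 ≤ k) : Function.Injective (gen (k := k)) := by
  intro i j hij
  by_contra hne
  have h : ∑ l, (if l = i ∨ l = j then 1 else 0) • gen l = (0 : Cube k) := by
    have : ∀ l : Dir k, (if l = i ∨ l = j then 1 else 0) • gen l =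
        (if l = i then gen l else 0) + (if l = j then gen l else (0 : Cube k)) := by
      intro l
      by_cases h1 : l = i
      · have : l ≠ j := fun h => hne (h1 ▸ h)
        simp [h1, hne]
      · by_cases h2 : l = j <;> simp [h1, h2, Ne.symm hne]
    simp only [this, Finset.sum_add_distrib, Finset.sum_ite_eq', Finset.mem_univ, if_true]
    rw [hij, cube_add_self]
  rcases parity_of_sum_smul_gen_eq_zero h with h | h
  · simpa using h i
  · have hcard : ∃ l, l ≠ i ∧ l ≠ j := by
      by_contra hcon
      push Not at hcon
      have : Fintype.card (Dir k) ≤ 2 := by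
        rw [← Finset.card_univ]
        refine (Finset.card_le_card (t := {i, j}) ?_).trans Finset.card_le_two
        intro l _
        by_cases hl : l = i
        · simp [hl]
        · simp [hcon l hl]
      rw [card_dir] at this
      omega
    obtain ⟨l, hl, hl'⟩ := hcard
    simpa [hl, hl'] using h l

lemma gen_ne_zero (hk : 1 ≤ k) (i : Dir k) : gen i ≠ (0 : Cube k) := by
  intro h
  have h1 : ∑ l, (if l = i then 1 else 0) • gen l = (0 : Cube k) := by simp [h]
  rcases parity_of_sum_smul_gen_eq_zero h1 with h2 | h2
  · simpa using h2 i
  · have : Nontrivial (Dir k) := by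
      rw [← Fintype.one_lt_card_iff_nontrivial, card_dir]; omega
    obtain ⟨j, hj⟩ := exists_ne i
    simpa [hj] using h2 j

/-- A subset of the folded cube that is closed under all generators is empty or everything. -/
lemma cube_induction {p : Cube k → Prop} {u : Cube k} (hu : p u)
    (hstep : ∀ v i, p v → p (v + gen i)) (v : Cube k) : p v := by
  suffices h : ∀ (s : Finset (Dir k)), p (u + ∑ i ∈ s, gen i) by
    obtain ⟨w, hw⟩ := QuotientAddGroup.mk_surjective (v - u)
    have h2 := sum_smul_gen (k := k) (fun i => (w i).val)
    simp only [ZMod.natCast_val, ZMod.cast_id', id_eq] at h2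
    have h3 := h (Finset.univ.filter fun i => w i = 1)
    rw [Finset.sum_filter] at h3
    have h4 : ∀ i, (w i).val • gen i = if w i = 1 then gen i else (0 : Cube k) := by
      intro i
      have h5 : ∀ x : ZMod 2, x.val = if x = 1 then 1 else 0 := by decide
      rw [h5]
      split_ifs <;> simp
    simp only [← h4] at h3
    rw [h2] at h3
    have h5 : u + (QuotientAddGroup.mk w : Cube k) = v := by rw [hw]; abel
    rwa [h5] at h3
  intro s
  induction s using Finset.induction_on with
  | empty => simpa
  | insert a s ha ih =>
    rw [Finset.sum_insert ha, add_comm (gen a), ← add_assoc]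
    exact hstep _ _ ih

/-- The multiset of directions used by a walk, when every edge changes the colour by a generator of
the folded cube. -/
lemma exists_direction_count {V : Type*} {G : SimpleGraph V} {c : V → Cube k}
    (hc : ∀ a b, G.Adj a b → ∃ i, c b = c a + gen i) {a b : V} (w : G.Walk a b) :
    ∃ n : Dir k → ℕ, ∑ i, n i = w.length ∧ c b = c a + ∑ i, n i • gen i := by
  induction w with
  | nil => exact ⟨0, by simp, by simp⟩
  | cons h p ih =>
    obtain ⟨n, hn, hcn⟩ := ih
    obtain ⟨i, hi⟩ := hc _ _ h
    refine ⟨n + Pi.single i 1, ?_, ?_⟩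
    · simp [Finset.sum_add_distrib, hn]
    · rw [hcn, hi]
      simp only [Pi.add_apply, add_smul, Finset.sum_add_distrib]
      have : ∑ j, (Pi.single i 1 : Dir k → ℕ) j • gen j = (gen i : Cube k) := by
        rw [Finset.sum_eq_single i] <;> simp +contextual
      rw [this]
      abel

/-- Odd walks between vertices of the same colour use every direction, so they are long. -/
lemma le_length_of_odd {V : Type*} {G : SimpleGraph V} {c : V → Cube k}
    (hc : ∀ a b, G.Adj a b → ∃ i, c b = c a + gen i) {a b : V} (w : G.Walk a b)
    (hw : Odd w.length) (hab : c a = c b) : 2 * k + 1 ≤ w.length := by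
  obtain ⟨n, hn, hcn⟩ := exists_direction_count hc w
  rw [hab, left_eq_add] at hcn
  rcases parity_of_sum_smul_gen_eq_zero hcn with h | h
  · exfalso
    rw [← hn] at hw
    exact (Nat.not_even_iff_odd.2 hw) (Finset.even_sum _ fun i _ => h i)
  · rw [← hn, ← card_dir, ← Finset.card_univ, Finset.card_eq_sum_ones]
    exact Finset.sum_le_sum fun i _ => (h i).pos

/-- A closed walk of odd length is a cycle if it is not longer than any other odd closed walk. -/
lemma isCycle_of_shortest_odd {V : Type*} {G : SimpleGraph V} {a : V} (p : G.Walk a a)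
    (h3 : 3 ≤ p.length) (hodd : Odd p.length)
    (hmin : ∀ b (w : G.Walk b b), Odd w.length → p.length ≤ w.length) : p.IsCycle := by
  have key : ∀ i j, 1 ≤ i → i < j → j ≤ p.length → p.getVert i ≠ p.getVert j := by
    intro i j hi hij hj heq
    let q : G.Walk (p.getVert i) (p.getVert i) :=
      ((p.drop i).take (j - i)).copy rfl (by
        rw [Walk.drop_getVert, heq]; congr 1; omega)
    have hq : q.length = j - i := by
      simp [q, Walk.take_length, Walk.drop_length]; omega
    let r : G.Walk a a := ((p.take i).copy rfl heq).append (p.drop j)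
    have hr : r.length = p.length - (j - i) := by
      simp [r, Walk.take_length, Walk.drop_length, Walk.length_append]; omega
    rcases Nat.even_or_odd (j - i) with h | h
    · have := hmin _ r (by rw [hr]; exact Nat.Odd.sub_even (by omega) hodd h)
      omega
    · have := hmin _ q (by rwa [hq])
      omega
  rw [Walk.isCycle_iff_isPath_tail_and_le_length]
  refine ⟨?_, h3⟩
  rw [← Walk.IsPath.getVert_injOn_iff]
  intro i hi j hj hij
  have hl : p.tail.length + 1 = p.length := by
    apply Walk.length_tail_add_one
    intro h
    rw [← Walk.length_eq_zero_iff] at h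
    omega
  simp only [Set.mem_ofPred_eq] at hi hj
  simp only [Walk.getVert_tail] at hij
  rcases lt_trichotomy i j with h | h | h
  · exact absurd hij (key (i + 1) (j + 1) (by omega) (by omega) (by omega))
  · exact h
  · exact absurd hij.symm (key (j + 1) (i + 1) (by omega) (by omega) (by omega))

/-! ### Graphs over the folded cube: a rigid core with attached vertices -/

/-- Data for a graph over the folded cube. Its core is a cover of the folded cube with fibre `X`, in
which the two directions of the `m`-th pair act on the fibre by the involution `rot m`. Every further
vertex `w : W` is joined to the points `nbr w` of the fibre over `pos w`, and `link` describes the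
edges between the further vertices. -/
structure Scaffold (k : ℕ) (X W : Type) where
  two_le : 2 ≤ k
  rot : Fin k → X → X
  rot_rot : ∀ m x, rot m (rot m x) = x
  rot_trans : ∀ T : Set X, T.Nonempty →
    (∀ m m' x, x ∈ T → rot m (rot m' (rot m (rot m' x))) ∈ T) → T = Set.univ
  pos : W → Cube k
  nbr : W → Finset X
  link : W → W → Prop
  link_symm : ∀ {w w'}, link w w' → link w' w
  link_pos : ∀ {w w'}, link w w' → pos w' = pos w + gen none

namespace Scaffold

variable {k : ℕ} {X W : Type} (s : Scaffold k X W)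

/-- The action of a direction on the fibre of the core. -/
def act : Dir k → X → X
  | none => id
  | some (m, _) => s.rot m

lemma act_act (i : Dir k) (x : X) : s.act i (s.act i x) = x := by
  match i with
  | none => rfl
  | some (m, _) => exact s.rot_rot m x

/-- The neighbour of a core vertex in direction `i`. -/
def step (i : Dir k) (q : Cube k × X) : Cube k × X := (q.1 + gen i, s.act i q.2)

@[simp] lemma step_fst (i : Dir k) (q : Cube k × X) : (s.step i q).1 = q.1 + gen i := rfl

lemma step_step (i : Dir k) (q : Cube k × X) : s.step i (s.step i q) = q := by
  simp [step, act_act, cube_add_add_self]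

/-- Adjacency in the graph of a scaffold. -/
def AdjRel : (Cube k × X) ⊕ W → (Cube k × X) ⊕ W → Prop
  | .inl q, .inl q' => ∃ i, q' = s.step i q
  | .inl q, .inr w => q.1 = s.pos w ∧ q.2 ∈ s.nbr w
  | .inr w, .inl q => q.1 = s.pos w ∧ q.2 ∈ s.nbr w
  | .inr w, .inr w' => s.link w w'

/-- The graph of a scaffold. -/
def graph : SimpleGraph ((Cube k × X) ⊕ W) where
  Adj := s.AdjRel
  symm := ⟨by
    rintro (q | w) (q' | w') h
    · obtain ⟨i, rfl⟩ := h
      exact ⟨i, (s.step_step i q).symm⟩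
    · exact h
    · exact h
    · exact s.link_symm h⟩
  loopless := ⟨by
    have hk := s.two_le
    rintro (q | w) h
    · obtain ⟨i, hi⟩ := h
      have := congrArg Prod.fst hi
      rw [step_fst, left_eq_add] at this
      exact gen_ne_zero (by omega) i this
    · have := s.link_pos h
      rw [left_eq_add] at this
      exact gen_ne_zero (by omega) none this⟩

/-- The colouring of the graph by the folded cube; along an edge at an attached vertex it changes
by the generator in direction `none`. -/
def color : (Cube k × X) ⊕ W → Cube k
  | .inl q => q.1
  | .inr w => s.pos w + gen none

variable {s}

lemma adj_inl_inl {q q' : Cube k × X} :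
    s.graph.Adj (.inl q) (.inl q') ↔ ∃ i, q' = s.step i q := Iff.rfl

lemma adj_inl_inr {q : Cube k × X} {w : W} :
    s.graph.Adj (.inl q) (.inr w) ↔ q.1 = s.pos w ∧ q.2 ∈ s.nbr w := Iff.rfl

lemma adj_inr_inr {w w' : W} : s.graph.Adj (.inr w) (.inr w') ↔ s.link w w' := Iff.rfl

lemma adj_step (i : Dir k) (q : Cube k × X) : s.graph.Adj (.inl q) (.inl (s.step i q)) := ⟨i, rfl⟩

lemma color_of_adj_inr {w : W} {b : (Cube k × X) ⊕ W} (h : s.graph.Adj (.inr w) b) :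
    s.color b = s.pos w := by
  rcases b with q | w'
  · exact h.1
  · have := s.link_pos h
    simp [color, this, cube_add_add_self]

lemma exists_color_eq (a b : (Cube k × X) ⊕ W) (h : s.graph.Adj a b) :
    ∃ i, s.color b = s.color a + gen i := by
  rcases a with q | w
  · rcases b with q' | w'
    · obtain ⟨i, rfl⟩ := h
      exact ⟨i, rfl⟩
    · exact ⟨none, by rw [color_of_adj_inr h.symm]; rfl⟩
  · exact ⟨none, by rw [color_of_adj_inr h]; simp [color, cube_add_add_self]⟩

/-! ### Short odd walks in the core -/

/-- The sum of the two generators of the `m`-th pair of directions. -/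
def pairGen (m : Fin k) : Cube k := gen (some (m, false)) + gen (some (m, true))

lemma gen_add_gen_not (m : Fin k) (b : Bool) :
    gen (some (m, b)) + gen (some (m, !b)) = pairGen m := by
  cases b
  · rfl
  · exact add_comm _ _

lemma gen_none_add_sum_pairGen : gen none + ∑ m, pairGen m = (0 : Cube k) := by
  rw [← sum_gen, Fintype.sum_option, Fintype.sum_prod_type]
  simp [pairGen, add_comm]

lemma step_pair (m : Fin k) (b : Bool) (u : Cube k) (x : X) :
    s.step (some (m, !b)) (s.step (some (m, b)) (u, x)) = (u + pairGen m, x) := by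
  simp [step, act, s.rot_rot, add_assoc, gen_add_gen_not]

lemma exists_walk_pairs (T : Finset (Fin k)) (u : Cube k) (x : X) :
    ∃ w : s.graph.Walk (.inl (u, x)) (.inl (u + ∑ m ∈ T, pairGen m, x)),
      w.length = 2 * T.card := by
  induction T using Finset.induction_on with
  | empty =>
    rw [Finset.sum_empty, add_zero]
    exact ⟨Walk.nil, rfl⟩
  | insert m T hm ih =>
    obtain ⟨w, hw⟩ := ih
    have h1 := adj_step (s := s) (some (m, false)) (u + ∑ m ∈ T, pairGen m, x)
    have h2 := adj_step (s := s) (some (m, !false))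
      (s.step (some (m, false)) (u + ∑ m ∈ T, pairGen m, x))
    rw [step_pair] at h2
    rw [Finset.sum_insert hm, add_comm (pairGen m), ← add_assoc]
    refine ⟨(w.concat h1).concat h2, ?_⟩
    rw [Walk.length_concat, Walk.length_concat, hw, Finset.card_insert_of_notMem hm]
    ring

/-- Two neighbours of a core vertex in different directions are joined by an odd walk of length
`2 * k - 1`; together with the two edges, it uses every direction exactly once. -/
lemma exists_walk_step_step {i j : Dir k} (hij : i ≠ j) (q : Cube k × X) :
    ∃ w : s.graph.Walk (.inl (s.step i q)) (.inl (s.step j q)), w.length = 2 * k - 1 := by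
  have hk := s.two_le
  have htot := gen_none_add_sum_pairGen (k := k)
  have hcard : ∀ m : Fin k, (Finset.univ.erase m).card = k - 1 := by
    intro m
    rw [Finset.card_erase_of_mem (Finset.mem_univ _), Finset.card_univ, Fintype.card_fin]
  have hnone : ∀ (m : Fin k) (b : Bool) (q : Cube k × X),
      ∃ w : s.graph.Walk (.inl (s.step none q)) (.inl (s.step (some (m, b)) q)),
        w.length = 2 * k - 1 := by
    rintro m b ⟨u, x⟩
    obtain ⟨w, hw⟩ := exists_walk_pairs (s := s) (Finset.univ.erase m) (u + gen none) x
    have he : s.step (some (m, b)) (u, x) =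
        s.step (some (m, !b)) (u + gen none + ∑ m ∈ Finset.univ.erase m, pairGen m, x) := by
      refine Prod.ext ?_ rfl
      apply eq_of_cube_add_eq_zero
      simp only [step_fst]
      rw [← Finset.add_sum_erase _ _ (Finset.mem_univ m), ← gen_add_gen_not m b] at htot
      calc _ = (u + u) + (gen none + (gen (some (m, b)) + gen (some (m, !b))
            + ∑ x ∈ Finset.univ.erase m, pairGen x)) := by abel
        _ = 0 := by rw [htot, cube_add_self, add_zero]
    rw [he, show s.step none (u, x) = (u + gen none, x) from rfl]
    refine ⟨w.concat (adj_step (some (m, !b)) _), ?_⟩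
    rw [Walk.length_concat, hw, hcard]
    omega
  match i, j with
  | none, none => exact absurd rfl hij
  | none, some (m, b) => exact hnone m b q
  | some (m, b), none =>
    obtain ⟨w, hw⟩ := hnone m b q
    exact ⟨w.reverse, by rw [Walk.length_reverse, hw]⟩
  | some (m, b), some (m', b') =>
    obtain ⟨u, x⟩ := q
    by_cases hm : m = m'
    · subst hm
      have hb : b' = !b := by
        cases b <;> cases b' <;> simp_all
      subst hb
      obtain ⟨w, hw⟩ := exists_walk_pairs (s := s) (Finset.univ.erase m)
        (u + gen (some (m, b))) (s.rot m x)
      have he : s.step (some (m, !b)) (u, x) = s.step none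
          (u + gen (some (m, b)) + ∑ m ∈ Finset.univ.erase m, pairGen m, s.rot m x) := by
        refine Prod.ext ?_ rfl
        apply eq_of_cube_add_eq_zero
        simp only [step_fst]
        rw [← Finset.add_sum_erase _ _ (Finset.mem_univ m), ← gen_add_gen_not m b] at htot
        calc _ = (u + u) + (gen none + (gen (some (m, b)) + gen (some (m, !b))
              + ∑ x ∈ Finset.univ.erase m, pairGen x)) := by abel
          _ = 0 := by rw [htot, cube_add_self, add_zero]
      rw [he, show s.step (some (m, b)) (u, x) = (u + gen (some (m, b)), s.rot m x) from rfl]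
      refine ⟨w.concat (adj_step none _), ?_⟩
      rw [Walk.length_concat, hw, hcard]
      omega
    · have hm' : m' ∈ Finset.univ.erase m := by simp [Ne.symm hm]
      obtain ⟨w, hw⟩ := exists_walk_pairs (s := s) ((Finset.univ.erase m).erase m')
        (u + pairGen m) x
      have h0 := adj_step (s := s) (some (m, !b)) (s.step (some (m, b)) (u, x))
      rw [step_pair] at h0
      have he : s.step (some (m', b')) (u, x) = s.step (some (m', !b')) (s.step none
          (u + pairGen m + ∑ m ∈ (Finset.univ.erase m).erase m', pairGen m, x)) := by
        refine Prod.ext ?_ rfl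
        apply eq_of_cube_add_eq_zero
        simp only [step_fst]
        rw [← Finset.add_sum_erase _ _ (Finset.mem_univ m), ← Finset.add_sum_erase _ _ hm',
          ← gen_add_gen_not m' b'] at htot
        calc _ = (u + u) + (gen none + (pairGen m + (gen (some (m', b')) + gen (some (m', !b'))
              + ∑ x ∈ (Finset.univ.erase m).erase m', pairGen x))) := by abel
          _ = 0 := by rw [htot, cube_add_self, add_zero]
      rw [he]
      refine ⟨Walk.cons h0 ((w.concat (adj_step none _)).concat (adj_step (some (m', !b')) _)), ?_⟩
      rw [Walk.length_cons, Walk.length_concat, Walk.length_concat, hw,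
        Finset.card_erase_of_mem hm', hcard]
      omega

/-- A set of core vertices that is closed under all steps is empty or everything. -/
lemma core_induction {p : Cube k × X → Prop} {q : Cube k × X} (hq : p q)
    (hstep : ∀ i q, p q → p (s.step i q)) (q' : Cube k × X) : p q' := by
  have hfib : ∀ u x, p (u, x) → ∀ y, p (u, y) := by
    intro u x hx y
    have := s.rot_trans {y | p (u, y)} ⟨x, hx⟩ (by
      intro m m' y hy
      have h := hstep (some (m, false)) _ (hstep (some (m', false)) _
        (hstep (some (m, false)) _ (hstep (some (m', false)) _ hy)))
      have hc : u + gen (some (m', false)) + gen (some (m, false)) + gen (some (m', false))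
          + gen (some (m, false)) = u := by
        apply eq_of_cube_add_eq_zero
        calc _ = (u + u) + (gen (some (m', false)) + gen (some (m', false)))
            + (gen (some (m, false)) + gen (some (m, false))) := by abel
          _ = 0 := by simp [cube_add_self]
      simp only [step, act, hc] at h
      exact h)
    have hy : y ∈ {y | p (u, y)} := this ▸ Set.mem_univ y
    exact hy
  obtain ⟨u, x⟩ := q
  obtain ⟨u', x'⟩ := q'
  exact cube_induction (p := fun u => ∀ x, p (u, x)) (hfib u x hq)
    (fun v i hv => hfib _ _ (hstep i _ (hv x))) u' x'

/-! ### Endomorphisms of a scaffold graph -/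

variable (f : s.graph →g s.graph)

lemma color_step_ne {i j : Dir k} (hij : i ≠ j) (q : Cube k × X) :
    s.color (f (.inl (s.step i q))) ≠ s.color (f (.inl (s.step j q))) := by
  intro h
  have hk := s.two_le
  obtain ⟨w, hw⟩ := exists_walk_step_step (s := s) hij q
  have := le_length_of_odd exists_color_eq (w.map f)
    (by rw [Walk.length_map, hw]; exact ⟨k - 1, by omega⟩) h
  rw [Walk.length_map, hw] at this
  omega

/-- Endomorphisms preserve the core: an attached vertex has only neighbours of one colour. -/
lemma exists_core_eq (q : Cube k × X) : ∃ q', f (.inl q) = .inl q' := by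
  rcases hq : f (.inl q) with q' | w
  · exact ⟨q', rfl⟩
  · exfalso
    have hk := s.two_le
    have hne : (none : Dir k) ≠ some (⟨0, by omega⟩, true) := by simp
    have h1 := f.map_adj (adj_step none q)
    have h2 := f.map_adj (adj_step (some (⟨0, by omega⟩, true)) q)
    rw [hq] at h1 h2
    exact color_step_ne f hne q ((color_of_adj_inr h1).trans (color_of_adj_inr h2).symm)

/-- The restriction of an endomorphism to the core. -/
noncomputable def coreMap (q : Cube k × X) : Cube k × X := (exists_core_eq f q).choose

lemma map_inl (q : Cube k × X) : f (.inl q) = .inl (coreMap f q) := (exists_core_eq f q).choose_spec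

/-- On the core, endomorphisms are locally bijective. -/
lemma exists_coreMap_step (q : Cube k × X) (j : Dir k) :
    ∃ i, coreMap f (s.step i q) = s.step j (coreMap f q) := by
  have h : ∀ i, ∃ j, coreMap f (s.step i q) = s.step j (coreMap f q) := by
    intro i
    have := f.map_adj (adj_step i q)
    rwa [map_inl, map_inl, adj_inl_inl] at this
  choose π hπ using h
  have hinj : Function.Injective π := by
    intro i i' hii
    by_contra hne
    apply color_step_ne f hne q
    rw [map_inl, map_inl, hπ, hπ, hii]
  obtain ⟨i, rfl⟩ := (Finite.injective_iff_surjective.1 hinj) j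
  exact ⟨i, hπ i⟩

lemma coreMap_surjective [Nonempty X] : Function.Surjective (coreMap f) := by
  obtain ⟨x⟩ := ‹Nonempty X›
  intro q
  refine core_induction (s := s) (p := fun q => ∃ q', coreMap f q' = q)
    ⟨((0 : Cube k), x), rfl⟩ ?_ q
  rintro i _ ⟨q, rfl⟩
  obtain ⟨j, hj⟩ := exists_coreMap_step f q i
  exact ⟨_, hj⟩

lemma coreMap_injective [Finite X] [Nonempty X] : Function.Injective (coreMap f) :=
  Finite.injective_iff_surjective.2 (coreMap_surjective f)

/-- An endomorphism that preserves the fibres of the core and fixes a core vertex is the identity on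
the core. -/
lemma coreMap_eq_self (hfib : ∀ q, (coreMap f q).1 = q.1) {q : Cube k × X}
    (hq : coreMap f q = q) (q' : Cube k × X) : coreMap f q' = q' := by
  have hk := s.two_le
  refine core_induction (s := s) (p := fun q => coreMap f q = q) hq ?_ q'
  intro i q hq
  obtain ⟨j, hj⟩ := exists_coreMap_step f q i
  have h1 := hfib (s.step j q)
  rw [hj, hq] at h1
  have : j = i := gen_injective (k := k) (by omega) (add_left_cancel h1.symm)
  subst this
  rw [hj, hq]

/-- Attached vertices of large enough degree into the core are mapped to attached vertices. -/
lemma exists_attached_eq [Finite X] [Nonempty X] {w : W} (hw : 2 * k + 1 < (s.nbr w).card) :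
    ∃ w', f (.inr w) = .inr w' := by
  rcases hq : f (.inr w) with q | w'
  · exfalso
    have h : ∀ x : s.nbr w, ∃ i, coreMap f (s.pos w, x.1) = s.step i q := by
      intro x
      have := f.map_adj (s.adj_inl_inr.2 ⟨rfl, x.2⟩ : s.graph.Adj (.inl (s.pos w, x.1)) (.inr w)).symm
      rwa [hq, map_inl, adj_inl_inl] at this
    choose π hπ using h
    have hinj : Function.Injective π := by
      intro x y hxy
      have h1 : coreMap f (s.pos w, x.1) = coreMap f (s.pos w, y.1) := by rw [hπ, hπ, hxy]
      exact Subtype.ext (congrArg Prod.snd (coreMap_injective f h1))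
    have := Fintype.card_le_of_injective π hinj
    rw [Fintype.card_coe, card_dir] at this
    omega
  · exact ⟨w', rfl⟩

lemma coreMap_of_mem_nbr {w w' : W} (hw : f (.inr w) = .inr w') {x : X} (hx : x ∈ s.nbr w) :
    (coreMap f (s.pos w, x)).1 = s.pos w' ∧ (coreMap f (s.pos w, x)).2 ∈ s.nbr w' := by
  have := f.map_adj (s.adj_inl_inr.2 ⟨rfl, hx⟩ : s.graph.Adj (.inl (s.pos w, x)) (.inr w))
  rwa [hw, map_inl, adj_inl_inr] at this

/-- If the neighbourhoods of the attached vertices connect each fibre, then an endomorphism that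
keeps some vertex of every fibre in its fibre preserves all fibres. -/
lemma coreMap_fst_eq [Finite X] [Nonempty X] (hcard : ∀ w, 2 * k + 1 < (s.nbr w).card)
    (hconn : ∀ (v : Cube k) (T : Set X), T.Nonempty →
      (∀ w, s.pos w = v → ∀ x ∈ s.nbr w, ∀ y ∈ s.nbr w, x ∈ T → y ∈ T) → T = Set.univ)
    (hpin : ∀ v, ∃ x, (coreMap f (v, x)).1 = v) (q : Cube k × X) : (coreMap f q).1 = q.1 := by
  obtain ⟨v, y⟩ := q
  obtain ⟨x, hx⟩ := hpin v
  have := hconn v {y | (coreMap f (v, y)).1 = v} ⟨x, hx⟩ (by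
    rintro w rfl x hx y hy hxT
    obtain ⟨w', hw'⟩ := exists_attached_eq f (hcard w)
    have h1 := (coreMap_of_mem_nbr f hw' hx).1
    have h2 := (coreMap_of_mem_nbr f hw' hy).1
    exact h2.trans (h1.symm.trans hxT))
  have hy : y ∈ {y | (coreMap f (v, y)).1 = v} := this ▸ Set.mem_univ y
  exact hy

/-! ### Odd girth and degrees -/

variable (s) in
lemma oddGirth_graph [Nonempty X] : s.graph.oddGirth = ((2 * k + 1 : ℕ) : ℕ∞) := by
  have hk := s.two_le
  have hmin : ∀ a (w : s.graph.Walk a a), Odd w.length → 2 * k + 1 ≤ w.length :=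
    fun a w hw => le_length_of_odd exists_color_eq w hw rfl
  apply le_antisymm
  · obtain ⟨x⟩ := ‹Nonempty X›
    let q : Cube k × X := (0, x)
    have hne : (none : Dir k) ≠ some (⟨0, by omega⟩, true) := by simp
    obtain ⟨w, hw⟩ := exists_walk_step_step (s := s) hne q
    let p := (Walk.cons (adj_step none q) w).concat (adj_step _ q).symm
    have hp : p.length = 2 * k + 1 := by
      simp only [p, Walk.length_concat, Walk.length_cons, hw]
      omega
    have hodd : Odd p.length := ⟨k, hp⟩
    have hcyc : p.IsCycle := isCycle_of_shortest_odd p (by omega) hodd (by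
      intro b w hw
      rw [hp]
      exact hmin b w hw)
    rw [← hp]
    exact (iInf_le _ _).trans ((iInf_le _ p).trans (iInf_le _ ⟨hcyc, hodd⟩))
  · refine le_iInf fun a => le_iInf fun w => le_iInf fun hw => ?_
    exact_mod_cast hmin a w hw.2

variable (s) in
/-- The degree of a core vertex is the number of directions plus the number of attached vertices
next to it. -/
lemma ncard_neighborSet_inl [Finite W] (q : Cube k × X) :
    (s.graph.neighborSet (.inl q)).ncard =
      2 * k + 1 + {w | s.pos w = q.1 ∧ q.2 ∈ s.nbr w}.ncard := by
  have hk := s.two_le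
  have h : s.graph.neighborSet (.inl q) =
      (fun i => Sum.inl (s.step i q)) '' (Set.univ : Set (Dir k)) ∪
        Sum.inr '' {w | s.pos w = q.1 ∧ q.2 ∈ s.nbr w} := by
    ext a
    rcases a with q' | w
    · simp [adj_inl_inl, eq_comm]
    · simp [adj_inl_inr, eq_comm]
  rw [h, Set.ncard_union_eq, Set.ncard_image_of_injective _ Sum.inr_injective,
    Set.ncard_image_of_injective, Set.ncard_univ, Nat.card_eq_fintype_card, card_dir]
  · intro i j hij
    have := congrArg Prod.fst (Sum.inl_injective hij)
    exact gen_injective (k := k) (by omega) (add_left_cancel this)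
  · rw [Set.disjoint_left]
    rintro _ ⟨i, -, rfl⟩ ⟨w, -, hw⟩
    cases hw

variable (s) in
/-- The degree of an attached vertex. -/
lemma ncard_neighborSet_inr [Finite W] (w : W) :
    (s.graph.neighborSet (.inr w)).ncard = (s.nbr w).card + {w' | s.link w w'}.ncard := by
  have h : s.graph.neighborSet (.inr w) =
      (fun x => Sum.inl (s.pos w, x)) '' (s.nbr w : Set X) ∪ Sum.inr '' {w' | s.link w w'} := by
    ext a
    rcases a with ⟨u, x⟩ | w'
    · simp only [mem_neighborSet, s.graph.adj_comm, adj_inl_inr]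
      simp [eq_comm, and_comm]
    · simp [adj_inr_inr]
  rw [h, Set.ncard_union_eq, Set.ncard_image_of_injective _ Sum.inr_injective,
    Set.ncard_image_of_injective, Set.ncard_coe_finset]
  · intro x y hxy
    simpa using hxy
  · rw [Set.disjoint_left]
    rintro _ ⟨i, -, rfl⟩ ⟨w, -, hw⟩
    cases hw

end Scaffold

/-! ### Involutions acting transitively on a fibre -/

/-- Every finite set with at least three points carries involutions, at least three in number, whose
squared products `(r m * r m') ^ 2` act transitively: on `ZMod N`, the reflections `-x` and `1 - x`
give the translation by `2`, and the transposition of `0` and `1` links the even residues to the odd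
ones. -/
lemma exists_rotations {k : ℕ} (hk : 3 ≤ k) (X : Type) [Finite X] (hX : 3 ≤ Nat.card X) :
    ∃ rot : Fin k → X → X, (∀ m x, rot m (rot m x) = x) ∧
      ∀ T : Set X, T.Nonempty →
        (∀ m m' x, x ∈ T → rot m (rot m' (rot m (rot m' x))) ∈ T) → T = Set.univ := by
  set N := Nat.card X with hN
  have : NeZero N := ⟨by omega⟩
  have e : X ≃ ZMod N := (Finite.equivFin X).trans (ZMod.finEquiv N).toEquiv
  let ρ : Fin k → ZMod N → ZMod N := fun m x =>
    if m.1 = 0 then -x else if m.1 = 1 then 1 - x else if m.1 = 2 then Equiv.swap 0 1 x else x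
  have hρ : ∀ m x, ρ m (ρ m x) = x := by
    intro m x
    simp only [ρ]
    split_ifs <;> simp
  refine ⟨fun m x => e.symm (ρ m (e x)), by simp [hρ], ?_⟩
  rintro T ⟨x₀, hx₀⟩ hT
  have hT' : ∀ m m' y, e.symm y ∈ T → e.symm (ρ m (ρ m' (ρ m (ρ m' y)))) ∈ T := by
    intro m m' y hy
    simpa using hT m m' _ hy
  have h2 : ∀ y, e.symm y ∈ T → e.symm (y + 2) ∈ T := by
    intro y hy
    have := hT' ⟨1, by omega⟩ ⟨0, by omega⟩ y hy
    have h : (1 : ZMod N) - -(1 - -y) = y + 2 := by ring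
    simp only [ρ, one_ne_zero, if_false, if_true, h] at this
    exact this
  have h10 : (1 : ZMod N) ≠ 0 := by
    have : Fact (1 < N) := ⟨by omega⟩
    exact one_ne_zero
  have hm1 : (-1 : ZMod N) ≠ 0 := by simpa using h10
  have hm2 : (-1 : ZMod N) ≠ 1 := by
    intro h
    have h' : ((2 : ℕ) : ZMod N) = 0 := by
      push_cast
      linear_combination -h
    rw [ZMod.natCast_eq_zero_iff] at h'
    have := Nat.le_of_dvd (by norm_num) h'
    omega
  have h01 : e.symm 0 ∈ T → e.symm 1 ∈ T := by
    intro h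
    have := hT' ⟨0, by omega⟩ ⟨2, by omega⟩ 0 h
    simpa [ρ, Equiv.swap_apply_of_ne_of_ne hm1 hm2] using this
  have h1 : e.symm 1 ∈ T → e.symm 0 ∈ T := by
    intro h
    have := hT' ⟨2, by omega⟩ ⟨0, by omega⟩ 1 h
    simpa [ρ, Equiv.swap_apply_of_ne_of_ne hm1 hm2] using this
  have h2j : ∀ (j : ℕ) y, e.symm y ∈ T → e.symm (y + 2 * j) ∈ T := by
    intro j
    induction j with
    | zero => intro y hy; simpa using hy
    | succ j ih =>
      intro y hy
      have := h2 _ (ih y hy)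
      have h : y + 2 * (j : ZMod N) + 2 = y + 2 * ((j + 1 : ℕ) : ZMod N) := by push_cast; ring
      rwa [h] at this
  have h0 : e.symm 0 ∈ T := by
    have hx : e.symm ((e x₀).val : ZMod N) ∈ T := by simpa using hx₀
    have hN0 : (N : ZMod N) = 0 := ZMod.natCast_self N
    rcases Nat.even_or_odd' (e x₀).val with ⟨a, ha | ha⟩
    · have := h2j ((N - 1) * a) _ hx
      rw [ha] at this
      have h : ((2 * a : ℕ) : ZMod N) + 2 * ((N - 1) * a : ℕ) = 0 := by
        rw [Nat.cast_mul, Nat.cast_mul, Nat.cast_sub (by omega), hN0]; push_cast; ring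
      rwa [h] at this
    · have := h2j ((N - 1) * a) _ hx
      rw [ha] at this
      have h : ((2 * a + 1 : ℕ) : ZMod N) + 2 * ((N - 1) * a : ℕ) = 1 := by
        rw [Nat.cast_add, Nat.cast_mul, Nat.cast_mul, Nat.cast_sub (by omega), hN0]
        push_cast; ring
      rw [h] at this
      exact h1 this
  rw [Set.eq_univ_iff_forall]
  intro x
  have hx : e.symm ((e x).val : ZMod N) = x := by simp
  rw [← hx]
  rcases Nat.even_or_odd' (e x).val with ⟨a, ha | ha⟩
  · have := h2j a 0 h0
    rw [ha]
    simpa using this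
  · have := h2j a 1 (h01 h0)
    rw [ha]
    simpa [add_comm] using this

/-! ### Completing the degrees by pads -/

/-- A bipartite graph with prescribed degrees `d q ≤ K` on one side and constant degree `g` on the
other side of size `K`. The edge ends at the first side are put into one row and dealt cyclically to
the second side. -/
lemma exists_dealing {F : Type} [Fintype F] (g K : ℕ) (d : F → ℕ) (hsum : ∑ q, d q = g * K)
    (hd : ∀ q, d q ≤ K) :
    ∃ R : F → Fin K → Prop, (∀ q, {i | R q i}.ncard = d q) ∧ ∀ i, {q | R q i}.ncard = g := by
  classical
  let e := Fintype.equivFin F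
  let n : Fin (Fintype.card F) → ℕ := fun q => d (e.symm q)
  have hn : ∑ q, n q = g * K := by
    rw [← hsum]
    exact Equiv.sum_comp e.symm d
  let E : (Σ q, Fin (n q)) ≃ Fin (g * K) := finSigmaFinEquiv.trans (finCongr hn)
  have hE : ∀ q (j j' : Fin (n q)), (E ⟨q, j⟩ : ℕ) + j' = E ⟨q, j'⟩ + j := by
    intro q j j'
    simp only [E, Equiv.trans_apply, finSigmaFinEquiv_apply, finCongr_apply, Fin.val_cast]
    ring
  have hlt : ∀ q (j : Fin (n q)), (j : ℕ) < K := fun q j => j.2.trans_le (hd _)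
  have hmod : ∀ q (j j' : Fin (n q)), (E ⟨q, j⟩ : ℕ) % K = E ⟨q, j'⟩ % K → j = j' := by
    intro q j j' h
    have h1 := hE q j j'
    have h2 : (E ⟨q, j⟩ : ℕ) ≡ E ⟨q, j'⟩ [MOD K] := h
    have h3 : (j' : ℕ) ≡ j [MOD K] := by
      refine Nat.ModEq.add_left_cancel h2 ?_
      rw [h1]
    have h4 := Nat.ModEq.eq_of_lt_of_lt h3 (hlt q j') (hlt q j)
    exact Fin.ext h4.symm
  refine ⟨fun q i => ∃ j : Fin (n (e q)), (E ⟨e q, j⟩ : ℕ) % K = i, ?_, ?_⟩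
  · intro q
    let r : Fin (n (e q)) → Fin K := fun j =>
      ⟨(E ⟨e q, j⟩ : ℕ) % K, Nat.mod_lt _ (Nat.zero_lt_of_lt (hlt _ j))⟩
    have hr : Function.Injective r := by
      intro j j' h
      exact hmod _ _ _ (congrArg Fin.val h)
    have : {i : Fin K | ∃ j : Fin (n (e q)), (E ⟨e q, j⟩ : ℕ) % K = i} = Set.range r := by
      ext i
      simp [r, Fin.ext_iff]
    rw [this, ← Set.image_univ, Set.ncard_image_of_injective _ hr, Set.ncard_univ]
    simp [n]
  · intro i
    have hb : ∀ a : Fin g, a * K + i < g * K := by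
      intro a
      calc (a : ℕ) * K + i < a * K + K := by omega
        _ = (a + 1) * K := by ring
        _ ≤ g * K := Nat.mul_le_mul_right _ a.2
    let r : Fin g → F := fun a => e.symm (E.symm ⟨a * K + i, hb a⟩).1
    have hr : Function.Injective r := by
      intro a a' h
      have h1 : (E.symm ⟨a * K + i, hb a⟩).1 = (E.symm ⟨a' * K + i, hb a'⟩).1 :=
        e.symm.injective h
      have h2 : E (E.symm ⟨a * K + i, hb a⟩) = ⟨a * K + i, hb a⟩ := E.apply_symm_apply _
      have h3 : E (E.symm ⟨a' * K + i, hb a'⟩) = ⟨a' * K + i, hb a'⟩ := E.apply_symm_apply _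
      generalize E.symm ⟨a * K + i, hb a⟩ = x at h1 h2
      generalize E.symm ⟨a' * K + i, hb a'⟩ = y at h1 h3
      obtain ⟨q, j⟩ := x
      obtain ⟨q', j'⟩ := y
      obtain rfl : q = q' := h1
      have h4 := hmod q j j' (by rw [h2, h3]; simp [Nat.add_mod])
      subst h4
      have h5 : (a : ℕ) * K + i = a' * K + i := congrArg Fin.val (h2.symm.trans h3)
      have h6 : (a : ℕ) * K = a' * K := by omega
      exact Fin.ext (Nat.eq_of_mul_eq_mul_right (Nat.zero_lt_of_lt i.2) h6)
    have : {q : F | ∃ j : Fin (n (e q)), (E ⟨e q, j⟩ : ℕ) % K = i} = Set.range r := by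
      ext q
      constructor
      · rintro ⟨j, hj⟩
        have h1 : (E ⟨e q, j⟩ : ℕ) / K < g := Nat.div_lt_of_lt_mul
          ((E ⟨e q, j⟩).2.trans_eq (mul_comm _ _))
        refine ⟨⟨(E ⟨e q, j⟩ : ℕ) / K, h1⟩, ?_⟩
        have h2 : (⟨(E ⟨e q, j⟩ : ℕ) / K * K + i, hb ⟨_, h1⟩⟩ : Fin (g * K)) = E ⟨e q, j⟩ := by
          ext
          simp only [← hj]
          exact Nat.div_add_mod' _ _
        simp only [r, h2]
        simp
      · rintro ⟨a, rfl⟩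
        have h2 : E (E.symm ⟨a * K + i, hb a⟩) = ⟨a * K + i, hb a⟩ := E.apply_symm_apply _
        simp only [r]
        generalize E.symm ⟨a * K + i, hb a⟩ = x at h2 ⊢
        obtain ⟨q, j⟩ := x
        rw [Set.mem_ofPred_eq, Equiv.apply_symm_apply]
        refine ⟨j, ?_⟩
        rw [h2]
        simp [Nat.mod_eq_of_lt i.2]
    rw [this, ← Set.image_univ, Set.ncard_image_of_injective _ hr, Set.ncard_univ]
    simp

section Arc

variable {K : ℕ} [NeZero K]

/-- The cyclic interval of length `n` in `ZMod K` that starts at `i`. -/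
def arc (n : ℕ) (i : ZMod K) : Finset (ZMod K) := Finset.univ.filter fun j => (j - i).val < n

lemma card_val_lt {n : ℕ} (hn : n ≤ K) :
    (Finset.univ.filter fun j : ZMod K => j.val < n).card = n := by
  have : (Finset.univ.filter fun j : ZMod K => j.val < n) =
      (Finset.univ : Finset (Fin n)).image fun a : Fin n => ((a : ℕ) : ZMod K) := by
    ext j
    simp only [Finset.mem_filter, Finset.mem_univ, true_and, Finset.mem_image]
    constructor
    · intro h
      exact ⟨⟨j.val, h⟩, by simp⟩
    · rintro ⟨a, rfl⟩
      rw [ZMod.val_natCast_of_lt (a.2.trans_le hn)]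
      exact a.2
  rw [this, Finset.card_image_of_injective, Finset.card_univ, Fintype.card_fin]
  intro a b hab
  have := congrArg ZMod.val hab
  simp only at this
  rw [ZMod.val_natCast_of_lt (a.2.trans_le hn), ZMod.val_natCast_of_lt (b.2.trans_le hn)] at this
  exact Fin.ext this

lemma card_arc {n : ℕ} (hn : n ≤ K) (i : ZMod K) : (arc n i).card = n := by
  refine Eq.trans ?_ (card_val_lt hn)
  refine Finset.card_bij (fun j _ => j - i) (by simp [arc]) (by simp) ?_
  intro b hb
  exact ⟨b + i, by simpa [arc] using hb, by simp⟩

lemma ncard_mem_arc {n : ℕ} (hn : n ≤ K) (j : ZMod K) : {i | j ∈ arc n i}.ncard = n := by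
  have : {i | j ∈ arc n i} = (Finset.univ.filter fun i : ZMod K => (j - i).val < n) := by
    ext i; simp [arc]
  rw [this, Set.ncard_coe_finset]
  refine Eq.trans ?_ (card_val_lt hn)
  refine Finset.card_bij (fun i _ => j - i) (by simp) (by simp) ?_
  intro b hb
  exact ⟨j - b, by simpa using hb, by simp⟩

lemma arc_injective {n : ℕ} (hn : 0 < n) (hnK : n < K) :
    Function.Injective (arc n : ZMod K → Finset (ZMod K)) := by
  intro i i' h
  by_contra hne
  have h1 : i ∈ arc n i' := by rw [← h]; simpa [arc]
  have h2 : i - 1 ∉ arc n i := by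
    simp only [arc, Finset.mem_filter, Finset.mem_univ, true_and, not_lt]
    have : i - 1 - i = -1 := by ring
    rw [this]
    obtain ⟨m, rfl⟩ : ∃ m, K = m + 1 := ⟨K - 1, by omega⟩
    rw [ZMod.val_neg_one]
    omega
  apply h2
  rw [h]
  simp only [arc, Finset.mem_filter, Finset.mem_univ, true_and] at h1 ⊢
  have h3 : (i - i').val ≠ 0 := by
    rw [Ne, ZMod.val_eq_zero]
    exact sub_ne_zero.2 hne
  have h4 : i - 1 - i' = (((i - i').val - 1 : ℕ) : ZMod K) := by
    rw [Nat.cast_sub (by omega)]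
    simp
    ring
  rw [h4, ZMod.val_natCast_of_lt (by omega)]
  omega

end Arc

/-- Pads complete a set `F` of points with missing degrees `d` to a set in which every point of `F`
gets its missing degree and every further point has degree `n`. A pad is joined to a cyclic interval
of `n` further points, which tells it from all other pads, and to `g` points of `F`. -/
lemma exists_pads {F : Type} [Fintype F] (g n K : ℕ) [NeZero K] (d : F → ℕ)
    (hsum : ∑ q, d q = g * K) (hd : ∀ q, 1 ≤ d q ∧ d q ≤ n) (hn : 2 ≤ n) (hnK : n < K) :
    ∃ P : ZMod K → Finset (F ⊕ ZMod K), (∀ i, (P i).card = g + n) ∧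
      (∀ q, {i | Sum.inl q ∈ P i}.ncard = d q) ∧ (∀ j, {i | Sum.inr j ∈ P i}.ncard = n) ∧
      Function.Injective P ∧
      ∀ T : Set (F ⊕ ZMod K), T.Nonempty →
        (∀ i, ∀ x ∈ P i, ∀ y ∈ P i, x ∈ T → y ∈ T) → T = Set.univ := by
  classical
  obtain ⟨R, hR1, hR2⟩ := exists_dealing g K d hsum (fun q => (hd q).2.trans hnK.le)
  let c : ZMod K ≃ Fin K := (ZMod.finEquiv K).symm.toEquiv
  let P : ZMod K → Finset (F ⊕ ZMod K) := fun i =>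
    (Finset.univ.filter fun q => R q (c i)).disjSum (arc n i)
  have hl : ∀ i q, Sum.inl q ∈ P i ↔ R q (c i) := by simp [P]
  have hr : ∀ i j, Sum.inr j ∈ P i ↔ j ∈ arc n i := by simp [P]
  refine ⟨P, ?_, ?_, ?_, ?_, ?_⟩
  · intro i
    simp only [P]
    rw [Finset.card_disjSum, card_arc hnK.le, ← hR2 (c i), ← Set.ncard_coe_finset]
    simp
  · intro q
    rw [← hR1 q, ← Set.ncard_image_of_injective _ c.injective]
    congr 1
    ext i
    simp only [hl, Set.mem_image, Set.mem_ofPred_eq]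
    exact ⟨fun ⟨x, hx, h⟩ => h ▸ hx, fun h => ⟨c.symm i, by simpa using h, by simp⟩⟩
  · intro j
    simp only [hr]
    exact ncard_mem_arc hnK.le j
  · intro i i' h
    apply arc_injective (by omega : 0 < n) hnK
    ext j
    rw [← hr, ← hr, h]
  · intro T hT h
    have hone : (1 : ZMod K).val < n := by
      have : Fact (1 < K) := ⟨by omega⟩
      rw [ZMod.val_one]; omega
    have hmem : ∀ i, Sum.inr i ∈ P i := by
      intro i; rw [hr]; simp [arc]; omega
    have hmem' : ∀ i, Sum.inr (i + 1) ∈ P i := by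
      intro i; rw [hr]; simpa [arc]
    have hstep : ∀ (m : ℕ) (j : ZMod K), Sum.inr j ∈ T → Sum.inr (j + m) ∈ T := by
      intro m
      induction m with
      | zero => intro j hj; simpa
      | succ m ih =>
        intro j hj
        have := h (j + m) _ (hmem _) _ (hmem' _) (ih j hj)
        rwa [add_assoc, ← Nat.cast_succ] at this
    have hall : ∀ j j' : ZMod K, Sum.inr j ∈ T → Sum.inr j' ∈ T := by
      intro j j' hj
      simpa using hstep (j' - j).val j hj
    have hex : ∀ q, ∃ i, Sum.inl q ∈ P i := by
      intro q
      have h1 := (hd q).1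
      rw [← hR1 q] at h1
      obtain ⟨i, hi⟩ := Set.nonempty_of_ncard_ne_zero (by omega : {i | R q i}.ncard ≠ 0)
      exact ⟨c.symm i, by rw [hl]; simpa using hi⟩
    have hr0 : ∃ j, Sum.inr j ∈ T := by
      obtain ⟨x | j, hx⟩ := hT
      · obtain ⟨i, hi⟩ := hex x
        exact ⟨i, h i _ hi _ (hmem i) hx⟩
      · exact ⟨j, hx⟩
    obtain ⟨j, hj⟩ := hr0
    rw [Set.eq_univ_iff_forall]
    rintro (x | j')
    · obtain ⟨i, hi⟩ := hex x
      exact h i _ (hmem i) _ hi (hall _ _ hj)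
    · exact hall _ _ hj

/-! ### Regular graphs from labelled patterns -/

/-- A bipartite graph with a labelling `rep` of its vertices, such that vertices with the same label
lie on the same side and have the same degree. The two marked vertices `a` and `b` are leaves whose
labels are not shared with any other vertex. -/
structure Pattern (Y : Type) where
  graph : SimpleGraph Y
  side : Y → Bool
  side_ne : ∀ {y y'}, graph.Adj y y' → side y ≠ side y'
  rep : Y → Y
  side_rep : ∀ y, side (rep y) = side y
  deg_eq : ∀ {y y'}, rep y = rep y' → (graph.neighborSet y).ncard = (graph.neighborSet y').ncard
  exists_adj : ∀ y, ∃ y', graph.Adj y y'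
  a : Y
  b : Y
  a_ne_b : a ≠ b
  rep_eq_a : ∀ {y}, rep y = a ↔ y = a
  rep_eq_b : ∀ {y}, rep y = b ↔ y = b
  deg_a : (graph.neighborSet a).ncard = 1
  deg_b : (graph.neighborSet b).ncard = 1

namespace Pattern

variable {Y : Type} (L : Pattern Y)

/-- The monoid of label-preserving endomorphisms of a pattern. -/
def labelEnd : Submonoid (L.graph →g L.graph) where
  carrier := {φ | ∀ y, L.rep (φ y) = L.rep y}
  mul_mem' := by
    intro φ ψ hφ hψ y
    rw [RelHom.mul_apply, hφ, hψ]
  one_mem' := fun _ => rfl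

/-- The degree of a vertex of a pattern. -/
noncomputable def deg (y : Y) : ℕ := (L.graph.neighborSet y).ncard

lemma side_eq_of_rep_eq {y y' : Y} (h : L.rep y = L.rep y') : L.side y = L.side y' := by
  rw [← L.side_rep y, h, L.side_rep]

lemma rep_a : L.rep L.a = L.a := L.rep_eq_a.2 rfl

lemma rep_b : L.rep L.b = L.b := L.rep_eq_b.2 rfl

variable {k : ℕ}

/-- The vertices attached to the fibres over `v` and `v + gen none` form two disjoint copies of the
pattern. This tells the copy, named by the fibre to which its first side is attached, that contains
the vertex `y` attached to the fibre over `v`. -/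
def copy (v : Cube k) (y : Y) : Cube k := if L.side y then v + gen none else v

/-- The name of the block of points to which a vertex is attached. In the copy `0`, vertices with
the same label share a block; in the other copies all vertices have different blocks. -/
noncomputable def lab (v : Cube k) (y : Y) : Y := if L.copy v y = 0 then L.rep y else y

variable {L}

lemma lab_a (v : Cube k) : L.lab v L.a = L.a := by
  simp [lab, L.rep_a]

lemma lab_b (v : Cube k) : L.lab v L.b = L.b := by
  simp [lab, L.rep_b]

lemma lab_eq_a {v : Cube k} {y : Y} : L.lab v y = L.a ↔ y = L.a := by
  unfold lab; split_ifs
  · exact L.rep_eq_a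
  · rfl

lemma lab_eq_b {v : Cube k} {y : Y} : L.lab v y = L.b ↔ y = L.b := by
  unfold lab; split_ifs
  · exact L.rep_eq_b
  · rfl

lemma side_lab (v : Cube k) (y : Y) : L.side (L.lab v y) = L.side y := by
  unfold lab; split_ifs
  · exact L.side_rep y
  · rfl

lemma copy_eq_of_side_eq {v : Cube k} {y y' : Y} (h : L.side y = L.side y') :
    L.copy v y = L.copy v y' := by
  simp [copy, h]

lemma copy_eq_of_lab_eq {v : Cube k} {y y' : Y} (h : L.lab v y = L.lab v y') :
    L.copy v y = L.copy v y' :=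
  copy_eq_of_side_eq (by rw [← side_lab v y, h, side_lab])

lemma rep_eq_of_lab_eq {v : Cube k} {y y' : Y} (h : L.lab v y = L.lab v y') :
    L.rep y = L.rep y' := by
  have hc := copy_eq_of_lab_eq h
  unfold lab at h
  rw [hc] at h
  split_ifs at h
  · exact h
  · rw [h]

lemma eq_of_lab_eq {v : Cube k} {y y' : Y} (hv : L.copy v y ≠ 0) (h : L.lab v y = L.lab v y') :
    y = y' := by
  have hc := copy_eq_of_lab_eq h
  unfold lab at h
  rw [← hc] at h
  simpa [hv] using h

lemma copy_map (φ : L.labelEnd) (v : Cube k) (y : Y) : L.copy v (φ.1 y) = L.copy v y :=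
  copy_eq_of_side_eq (L.side_eq_of_rep_eq (φ.2 y))

/-- The action of a label-preserving endomorphism on the copies of the pattern: only the vertices
of the copy `0` are moved. -/
noncomputable def moved (φ : L.labelEnd) (v : Cube k) (y : Y) : Y :=
  if L.copy v y = 0 then φ.1 y else y

lemma lab_moved (φ : L.labelEnd) (v : Cube k) (y : Y) : L.lab v (moved φ v y) = L.lab v y := by
  unfold moved
  split_ifs with h
  · unfold lab
    rw [copy_map, if_pos h, if_pos h]
    exact φ.2 y
  · rfl

lemma copy_eq_of_adj {v : Cube k} {y y' : Y} (h : L.graph.Adj y y') :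
    L.copy (v + gen none) y' = L.copy v y := by
  have := L.side_ne h
  unfold copy
  cases h1 : L.side y <;> cases h2 : L.side y' <;> simp_all [cube_add_add_self]

variable (L) in
/-- The fibre to which the vertex `y` of the copy `0` of the pattern is attached. -/
def base (k : ℕ) (y : Y) : Cube k := if L.side y then gen none else 0

lemma copy_base (y : Y) : L.copy (base L k y) y = 0 := by
  unfold copy base
  cases L.side y <;> simp [cube_add_self]

variable (L) [Fintype Y]

lemma one_le_deg (y : Y) : 1 ≤ L.deg y := by
  obtain ⟨y', h⟩ := L.exists_adj y
  exact (Set.ncard_pos (Set.toFinite _)).2 ⟨y', h⟩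

lemma deg_le (y : Y) : L.deg y ≤ Fintype.card Y := by
  rw [← Nat.card_eq_fintype_card, ← Set.ncard_univ]
  exact Set.ncard_le_ncard (Set.subset_univ _)

/-! #### Parameters -/

/-- The number of attached vertices next to each core vertex. -/
def attDeg (k t : ℕ) : ℕ := (2 * k + 1) * t + 1

/-- The degree of the regular graph. -/
def degree (k t : ℕ) : ℕ := attDeg k t + (2 * k + 1)

/-- The number of pads attached to each fibre. -/
noncomputable def padCount (k t : ℕ) : ℕ :=
  Fintype.card Y * degree k t * t + (∑ y, L.deg y) * (1 + 2 * k * t)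

/-- The points of a fibre that may be joined to vertices of the pattern. The points of the second
kind are not; their number makes the number of missing edges a multiple of `2 * k + 1`. -/
abbrev Pt (k t : ℕ) := (Y × Fin (degree k t)) ⊕ Fin (2 * k * ∑ y, L.deg y)

/-- The fibre of the core: the points together with one further point for each pad. -/
abbrev Fibre (k t : ℕ) := L.Pt k t ⊕ ZMod (L.padCount k t)

/-- The attached vertices: copies of the pattern, and pads. -/
abbrev Att (k t : ℕ) := (Cube k × Y) ⊕ (Cube k × ZMod (L.padCount k t))

/-- A numbering of the vertices of the folded cube by positive integers. -/
noncomputable def code {k : ℕ} (v : Cube k) : ℕ := Fintype.equivFin (Cube k) v + 1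

lemma code_injective {k : ℕ} : Function.Injective (code (k := k)) := by
  intro u v h
  exact (Fintype.equivFin (Cube k)).injective (Fin.ext (Nat.add_right_cancel h))

lemma one_le_code {k : ℕ} (v : Cube k) : 1 ≤ code v := Nat.le_add_left _ _

lemma code_le {k : ℕ} (v : Cube k) : code v ≤ Fintype.card (Cube k) :=
  (Fintype.equivFin (Cube k) v).2

lemma exists_code_eq_one (k : ℕ) : ∃ v : Cube k, code v = 1 := by
  have h : 0 < Fintype.card (Cube k) := Fintype.card_pos
  exact ⟨(Fintype.equivFin (Cube k)).symm ⟨0, h⟩, by simp [code]⟩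

variable (Y) in
/-- The conditions under which the parameter `t` is large enough for patterns on `Y`. -/
structure Large (k t : ℕ) : Prop where
  three_le : 3 ≤ k
  one_le : 1 ≤ t
  card_lt : Fintype.card Y < attDeg k t
  cube_lt : Fintype.card (Cube k) + 2 ≤ degree k t

variable {t : ℕ}

lemma Large.deg_lt (h : Large Y k t) (L : Pattern Y) (y : Y) :
    L.deg y + (2 * k + 1) < degree k t := by
  have := L.deg_le y
  have := h.card_lt
  unfold degree
  omega

lemma Large.two_le_attDeg (h : Large Y k t) : 2 ≤ attDeg k t := by
  have h1 : 1 ≤ (2 * k + 1) * t := Nat.mul_pos (by omega) h.one_le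
  unfold attDeg
  omega

lemma Large.attDeg_lt (h : Large Y k t) (L : Pattern Y) : attDeg k t < L.padCount k t := by
  have h1 : 0 < Fintype.card Y := Fintype.card_pos_iff.2 ⟨L.a⟩
  have h3 := h.one_le
  have h4 : degree k t ≤ Fintype.card Y * degree k t * t := by
    calc degree k t = 1 * degree k t * 1 := by ring
      _ ≤ _ := Nat.mul_le_mul (Nat.mul_le_mul_right _ h1) h3
  have h5 : attDeg k t < degree k t := by unfold degree; omega
  unfold padCount
  omega

lemma padCount_pos (h : Large Y k t) : 0 < L.padCount k t := (Nat.zero_le _).trans_lt (h.attDeg_lt L)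

lemma finite_fibre (h : Large Y k t) : Finite (L.Fibre k t) := by
  have : NeZero (L.padCount k t) := ⟨(L.padCount_pos h).ne'⟩
  infer_instance

lemma nonempty_fibre (h : Large Y k t) : Nonempty (L.Fibre k t) :=
  ⟨.inl (.inl (L.a, ⟨0, by have := h.deg_lt L L.a; omega⟩))⟩

lemma Large.code_lt (h : Large Y k t) (v : Cube k) : code v + 2 ≤ degree k t := by
  have := code_le v
  have := h.cube_lt
  omega

/-- The injection of the numbers below the degree into the points, with blocks chosen by `c`. -/
def ptEmb (c : Fin (degree k t) → Y) : Fin (degree k t) ↪ L.Pt k t :=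
  ⟨fun j => Sum.inl (c j, j), fun _ _ h => (Prod.ext_iff.1 (Sum.inl_injective h)).2⟩

variable {L} in
lemma ptEmb_apply (c : Fin (degree k t) → Y) (j : Fin (degree k t)) :
    L.ptEmb c j = Sum.inl (c j, j) := rfl

variable [DecidableEq Y]

/-- The neighbours among the points of the vertex `y` attached to the fibre over `v`. They lie in one
block, except that `code v` of the neighbours of `b` lie in the block of `a`. -/
noncomputable def ptNbr (t : ℕ) (v : Cube k) (y : Y) : Finset (L.Pt k t) :=
  (Finset.univ.filter fun j : Fin (degree k t) => (j : ℕ) < degree k t - L.deg y).map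
    (L.ptEmb fun j => if y = L.b ∧ (j : ℕ) < code v then L.a else L.lab v y)

/-- The number of edges to pads that a point needs. The subtraction does not truncate for large
parameters. -/
noncomputable def missing (v : Cube k) (q : L.Pt k t) : ℕ :=
  attDeg k t - (Finset.univ.filter fun y => q ∈ L.ptNbr t v y).card

lemma card_ptNbr (v : Cube k) (y : Y) : (L.ptNbr t v y).card = degree k t - L.deg y := by
  rw [ptNbr, Finset.card_map]
  have h : (Finset.univ.filter fun j : Fin (degree k t) => (j : ℕ) < degree k t - L.deg y).card =
      min (degree k t) (degree k t - L.deg y) := Fin.card_filter_val_lt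
  rw [h]
  omega

variable {L}

lemma mem_ptNbr {v : Cube k} {y z : Y} {j : Fin (degree k t)} :
    Sum.inl (z, j) ∈ L.ptNbr t v y ↔
      (j : ℕ) < degree k t - L.deg y ∧ (if y = L.b ∧ (j : ℕ) < code v then L.a else L.lab v y) = z := by
  simp only [ptNbr, Finset.mem_map, Finset.mem_filter, Finset.mem_univ, true_and,
    ptEmb_apply, Sum.inl.injEq, Prod.mk.injEq]
  constructor
  · rintro ⟨i, hi, h, rfl⟩
    exact ⟨hi, h⟩
  · rintro ⟨hi, h⟩
    exact ⟨j, hi, h, rfl⟩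

lemma not_mem_ptNbr_inr {v : Cube k} {y : Y} {j} : Sum.inr j ∉ L.ptNbr t v y := by
  simp [ptNbr, ptEmb_apply]

lemma ptNbr_congr {v : Cube k} {y y' : Y} (hb : y = L.b ↔ y' = L.b)
    (hl : L.lab v y = L.lab v y') : L.ptNbr t v y = L.ptNbr t v y' := by
  have hd : L.deg y = L.deg y' := L.deg_eq (rep_eq_of_lab_eq hl)
  ext (⟨z, j⟩ | j)
  · simp only [mem_ptNbr, hb, hl, hd]
  · simp [not_mem_ptNbr_inr]

/-- Each point misses at least one edge. -/
lemma Large.missing_pos (h : Large Y k t) (v : Cube k) (q : L.Pt k t) : 1 ≤ L.missing v q := by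
  have h1 : (Finset.univ.filter fun y => q ∈ L.ptNbr t v y).card ≤ Fintype.card Y :=
    Finset.card_le_univ _
  have := h.card_lt
  unfold missing
  omega

lemma Large.card_add_missing (h : Large Y k t) (v : Cube k) (q : L.Pt k t) :
    (Finset.univ.filter fun y => q ∈ L.ptNbr t v y).card + L.missing v q = attDeg k t := by
  have h1 : (Finset.univ.filter fun y => q ∈ L.ptNbr t v y).card ≤ Fintype.card Y :=
    Finset.card_le_univ _
  have := h.card_lt
  unfold missing
  omega

/-- The pads have room for exactly the missing edges if each of them takes `2 * k + 1`. -/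
lemma Large.sum_missing (h : Large Y k t) (v : Cube k) :
    ∑ q, L.missing (t := t) v q = (2 * k + 1) * L.padCount k t := by
  have h1 : ∑ q : L.Pt k t, (Finset.univ.filter fun y => q ∈ L.ptNbr t v y).card =
      ∑ y, (L.ptNbr t v y).card := by
    simp only [Finset.card_filter]
    rw [Finset.sum_comm]
    refine Finset.sum_congr rfl fun y _ => ?_
    rw [← Finset.card_filter]
    congr 1
    ext; simp
  have h2 : ∑ y, (L.ptNbr t v y).card + ∑ y, L.deg y = Fintype.card Y * degree k t := by
    rw [← Finset.sum_add_distrib, ← smul_eq_mul, ← Finset.card_univ, ← Finset.sum_const]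
    refine Finset.sum_congr rfl fun y _ => ?_
    have := h.deg_lt L y
    rw [card_ptNbr]
    omega
  have h3 : ∑ q : L.Pt k t, (Finset.univ.filter fun y => q ∈ L.ptNbr t v y).card +
      ∑ q, L.missing (t := t) v q =
      (Fintype.card Y * degree k t + 2 * k * ∑ y, L.deg y) * attDeg k t := by
    rw [← Finset.sum_add_distrib, Finset.sum_congr rfl fun q _ => h.card_add_missing v q]
    simp
  rw [h1] at h3
  generalize hS : ∑ y, (L.ptNbr t v y).card = S at h2 h3
  generalize hM : ∑ q, L.missing (t := t) v q = m at h3 ⊢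
  unfold padCount
  generalize ∑ y, L.deg y = s at h2 h3 ⊢
  generalize hn : Fintype.card Y * degree k t = n at h2 h3 ⊢
  unfold attDeg at h3
  zify at h2 h3 ⊢
  linear_combination h3 - h2

/-! #### How the neighbourhoods of the attached vertices meet -/

/-- If the neighbourhood of one vertex contains that of another one, both have the same block. -/
lemma Large.lab_eq_of_subset (h : Large Y k t) {v : Cube k} {y y' : Y}
    (hs : L.ptNbr t v y ⊆ L.ptNbr t v y') : L.lab v y = L.lab v y' := by
  have hd := h.deg_lt L y
  have h1 := one_le_code v
  have h2 := h.code_lt v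
  let j₀ : Fin (degree k t) := ⟨0, by omega⟩
  let j₁ : Fin (degree k t) := ⟨degree k t - 2, by omega⟩
  have hdb : L.deg L.b = 1 := L.deg_b
  by_cases hy : y = L.b
  · subst hy
    have h3 := hs (mem_ptNbr.2 ⟨by simp [j₀]; omega, rfl⟩ : Sum.inl (_, j₀) ∈ _)
    have h4 := hs (mem_ptNbr.2 ⟨by simp [j₁]; omega, rfl⟩ : Sum.inl (_, j₁) ∈ _)
    rw [mem_ptNbr] at h3 h4
    by_cases hy' : y' = L.b
    · rw [hy']
    · have h5 : ¬ (degree k t - 2 < code v) := by omega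
      simp only [hy', false_and, if_false, true_and, j₀, j₁, h5, lab_b] at h3 h4
      rw [if_pos (by omega)] at h3
      exact absurd (h3.2.symm.trans h4.2) L.a_ne_b
  · have h3 := hs (mem_ptNbr.2 ⟨by simp [j₀]; omega, rfl⟩ : Sum.inl (_, j₀) ∈ _)
    rw [mem_ptNbr] at h3
    by_cases hy' : y' = L.b
    · subst hy'
      simp only [hy, false_and, if_false, true_and, j₀] at h3
      rw [if_pos (by omega)] at h3
      have hya : y = L.a := lab_eq_a.1 h3.2.symm
      subst hya
      have hda : L.deg L.a = 1 := L.deg_a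
      have h4 := hs (mem_ptNbr.2 ⟨by simp [j₁]; omega, rfl⟩ : Sum.inl (_, j₁) ∈ _)
      rw [mem_ptNbr] at h4
      simp only [hy, false_and, if_false, true_and, j₁, lab_a, lab_b] at h4
      rw [if_neg (by omega)] at h4
      exact absurd h4.2.symm L.a_ne_b
    · simp only [hy, hy', false_and, if_false] at h3
      exact h3.2.symm

lemma Large.mem_ptNbr_inter (h : Large Y k t) {v : Cube k} {z : Y} {j : Fin (degree k t)} :
    Sum.inl (z, j) ∈ L.ptNbr t v L.a ∩ L.ptNbr t v L.b ↔ z = L.a ∧ (j : ℕ) < code v := by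
  have hda : L.deg L.a = 1 := L.deg_a
  have hdb : L.deg L.b = 1 := L.deg_b
  have h2 := h.code_lt v
  rw [Finset.mem_inter, mem_ptNbr, mem_ptNbr, hda, hdb]
  simp only [L.a_ne_b, false_and, if_false, true_and, lab_a, lab_b]
  by_cases hj : (j : ℕ) < code v
  · simp only [hj, if_true, and_true]
    constructor
    · rintro ⟨h3, -⟩
      exact h3.2.symm
    · rintro rfl
      exact ⟨⟨by omega, rfl⟩, by omega, rfl⟩
  · simp only [hj, if_false, and_false, iff_false]
    rintro ⟨⟨-, h3⟩, -, h4⟩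
    exact L.a_ne_b (h3.trans h4.symm)

lemma Large.card_ptNbr_inter (h : Large Y k t) (v : Cube k) :
    (L.ptNbr t v L.a ∩ L.ptNbr t v L.b).card = code v := by
  have h2 := h.code_lt v
  have : L.ptNbr t v L.a ∩ L.ptNbr t v L.b =
      (Finset.univ.filter fun j : Fin (degree k t) => (j : ℕ) < code v).map
        (L.ptEmb fun _ => L.a) := by
    ext (⟨z, j⟩ | j)
    · rw [h.mem_ptNbr_inter]
      simp only [Finset.mem_map, Finset.mem_filter, Finset.mem_univ, true_and, ptEmb_apply,
        Sum.inl.injEq, Prod.mk.injEq]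
      exact ⟨fun ⟨hz, hj⟩ => ⟨j, hj, hz.symm, rfl⟩, fun ⟨i, hi, hz, hij⟩ => ⟨hz.symm, hij ▸ hi⟩⟩
    · simp [not_mem_ptNbr_inr, ptEmb_apply]
  rw [this, Finset.card_map]
  have h : (Finset.univ.filter fun j : Fin (degree k t) => (j : ℕ) < code v).card =
      min (degree k t) (code v) := Fin.card_filter_val_lt
  rw [h]
  omega

/-- The leaves `a` and `b` are the only vertices attached to a fibre whose neighbourhoods are
different and not disjoint. -/
lemma eq_of_ptNbr_inter {v : Cube k} {y y' : Y} (hne : L.ptNbr t v y ≠ L.ptNbr t v y')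
    (hi : (L.ptNbr t v y ∩ L.ptNbr t v y').Nonempty) :
    (y = L.a ∧ y' = L.b) ∨ (y = L.b ∧ y' = L.a) := by
  obtain ⟨⟨z, j⟩ | j, hz⟩ := hi
  · rw [Finset.mem_inter, mem_ptNbr, mem_ptNbr] at hz
    obtain ⟨⟨-, h1⟩, -, h2⟩ := hz
    by_cases hb : y = L.b
    · by_cases hb' : y' = L.b
      · exact absurd (by rw [hb, hb']) hne
      · refine Or.inr ⟨hb, ?_⟩
        simp only [hb', false_and, if_false] at h2
        rw [← h2] at h1
        split_ifs at h1
        · exact lab_eq_a.1 h1.symm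
        · rw [hb, lab_b] at h1
          exact absurd (lab_eq_b.1 h1.symm) hb'
    · by_cases hb' : y' = L.b
      · refine Or.inl ⟨?_, hb'⟩
        simp only [hb, false_and, if_false] at h1
        rw [← h1] at h2
        split_ifs at h2
        · exact lab_eq_a.1 h2.symm
        · rw [hb', lab_b] at h2
          exact absurd (lab_eq_b.1 h2.symm) hb
      · simp only [hb, hb', false_and, if_false] at h1 h2
        exact absurd (ptNbr_congr (by simp [hb, hb']) (h1.trans h2.symm)) hne
  · simp [not_mem_ptNbr_inr] at hz

end Pattern

/-! ### The regular graph of a pattern -/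

namespace Pattern

variable {Y : Type} (L : Pattern Y) [Fintype Y] [DecidableEq Y] {k t : ℕ}

/-- The choices that enter the construction of the regular graph: involutions of the fibre that make
the core connected, and for every fibre a system of pads supplying the missing edges. -/
structure Choices (k t : ℕ) where
  large : Large Y k t
  rot : Fin k → L.Fibre k t → L.Fibre k t
  rot_rot : ∀ m x, rot m (rot m x) = x
  rot_trans : ∀ T : Set (L.Fibre k t), T.Nonempty →
    (∀ m m' x, x ∈ T → rot m (rot m' (rot m (rot m' x))) ∈ T) → T = Set.univ
  pad : Cube k → ZMod (L.padCount k t) → Finset (L.Fibre k t)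
  card_pad : ∀ v i, (pad v i).card = degree k t
  ncard_inl : ∀ v q, {i | Sum.inl q ∈ pad v i}.ncard = L.missing v q
  ncard_inr : ∀ v j, {i | Sum.inr j ∈ pad v i}.ncard = attDeg k t
  pad_injective : ∀ v, Function.Injective (pad v)
  pad_conn : ∀ v, ∀ T : Set (L.Fibre k t), T.Nonempty →
    (∀ i, ∀ x ∈ pad v i, ∀ y ∈ pad v i, x ∈ T → y ∈ T) → T = Set.univ

lemma nonempty_choices (h : Large Y k t) : Nonempty (L.Choices k t) := by
  have h0 : NeZero (L.padCount k t) := ⟨(L.padCount_pos h).ne'⟩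
  have hX : 3 ≤ Nat.card (L.Fibre k t) := by
    have h1 : L.padCount k t ≤ Nat.card (L.Fibre k t) := by
      rw [Nat.card_sum, Nat.card_zmod]
      exact Nat.le_add_left _ _
    have h2 := h.attDeg_lt L
    have h3 := h.two_le_attDeg
    omega
  obtain ⟨rot, h1, h2⟩ := exists_rotations h.three_le (L.Fibre k t) hX
  have hpad := fun v : Cube k => exists_pads (2 * k + 1) (attDeg k t) (L.padCount k t)
    (L.missing (t := t) v) (h.sum_missing v)
    (fun q => ⟨h.missing_pos v q, by unfold missing; omega⟩) h.two_le_attDeg (h.attDeg_lt L)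
  choose P hP1 hP2 hP3 hP4 hP5 using hpad
  exact ⟨⟨h, rot, h1, h2, P, fun v i => (hP1 v i).trans (add_comm _ _), hP2, hP3, hP4, hP5⟩⟩

namespace Choices

variable {L} (C : L.Choices k t)

/-- The scaffold of a pattern. -/
noncomputable def scaffold : Scaffold k (L.Fibre k t) (L.Att k t) where
  two_le := by have := C.large.three_le; omega
  rot := C.rot
  rot_rot := C.rot_rot
  rot_trans := C.rot_trans
  pos := Sum.elim Prod.fst Prod.fst
  nbr := Sum.elim (fun p => (L.ptNbr t p.1 p.2).map .inl) (fun p => C.pad p.1 p.2)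
  link w w' := match w, w' with
    | .inl p, .inl p' => p'.1 = p.1 + gen none ∧ L.graph.Adj p.2 p'.2
    | _, _ => False
  link_symm := by
    rintro (⟨v, y⟩ | p) (⟨v', y'⟩ | p') h
    · obtain ⟨h1, h2⟩ : v' = v + gen none ∧ L.graph.Adj y y' := h
      refine ⟨?_, h2.symm⟩
      change v = v' + gen none
      rw [h1, cube_add_add_self]
    · exact h
    · exact h
    · exact h
  link_pos := by
    rintro (⟨v, y⟩ | p) (⟨v', y'⟩ | p') h
    · exact h.1
    · exact h.elim
    · exact h.elim
    · exact h.elim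

/-- The regular graph of a pattern. -/
noncomputable abbrev G : SimpleGraph ((Cube k × L.Fibre k t) ⊕ L.Att k t) := C.scaffold.graph

lemma pos_inl (p : Cube k × Y) : C.scaffold.pos (.inl p) = p.1 := rfl

lemma pos_inr (p : Cube k × ZMod (L.padCount k t)) : C.scaffold.pos (.inr p) = p.1 := rfl

lemma nbr_inl (p : Cube k × Y) : C.scaffold.nbr (.inl p) = (L.ptNbr t p.1 p.2).map .inl := rfl

lemma nbr_inr (p : Cube k × ZMod (L.padCount k t)) : C.scaffold.nbr (.inr p) = C.pad p.1 p.2 := rfl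

lemma link_inl {p p' : Cube k × Y} :
    C.scaffold.link (.inl p) (.inl p') ↔ p'.1 = p.1 + gen none ∧ L.graph.Adj p.2 p'.2 := Iff.rfl

lemma card_nbr_inl (p : Cube k × Y) :
    (C.scaffold.nbr (.inl p)).card = degree k t - L.deg p.2 := by
  rw [nbr_inl, Finset.card_map, card_ptNbr]

lemma lt_card_nbr (w : L.Att k t) : 2 * k + 1 < (C.scaffold.nbr w).card := by
  rcases w with p | p
  · have := C.large.deg_lt L p.2
    rw [card_nbr_inl]
    omega
  · rw [nbr_inr, C.card_pad]
    have := C.large.two_le_attDeg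
    unfold degree
    omega

/-! #### Degrees -/

lemma ncard_neighborSet (x : (Cube k × L.Fibre k t) ⊕ L.Att k t) :
    (C.G.neighborSet x).ncard = degree k t := by
  have h0 : NeZero (L.padCount k t) := ⟨(L.padCount_pos C.large).ne'⟩
  rcases x with ⟨v, x⟩ | w
  · rw [Scaffold.ncard_neighborSet_inl]
    have h : {w | C.scaffold.pos w = v ∧ x ∈ C.scaffold.nbr w} =
        (fun y => Sum.inl (v, y)) '' {y | x ∈ (L.ptNbr t v y).map .inl} ∪
          (fun i => Sum.inr (v, i)) '' {i | x ∈ C.pad v i} := by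
      ext (⟨v', y⟩ | ⟨v', i⟩)
      · simp only [pos_inl, nbr_inl, Set.mem_ofPred_eq, Set.mem_union, Set.mem_image, Sum.inl.injEq,
          Prod.mk.injEq, reduceCtorEq, and_false, exists_false, or_false]
        constructor
        · rintro ⟨rfl, h⟩
          exact ⟨y, h, rfl, rfl⟩
        · rintro ⟨y, h, rfl, rfl⟩
          exact ⟨rfl, h⟩
      · simp only [pos_inr, nbr_inr, Set.mem_ofPred_eq, Set.mem_union, Set.mem_image, Sum.inr.injEq,
          Prod.mk.injEq, reduceCtorEq, and_false, exists_false, false_or]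
        constructor
        · rintro ⟨rfl, h⟩
          exact ⟨i, h, rfl, rfl⟩
        · rintro ⟨y, h, rfl, rfl⟩
          exact ⟨rfl, h⟩
    have hatt : {w | C.scaffold.pos w = v ∧ x ∈ C.scaffold.nbr w}.ncard = attDeg k t := by
      rw [h, Set.ncard_union_eq, Set.ncard_image_of_injective, Set.ncard_image_of_injective]
      · rcases x with q | j
        · rw [C.ncard_inl, ← C.large.card_add_missing v q, ← Set.ncard_coe_finset]
          simp
        · rw [C.ncard_inr]
          simp
      · intro i j h
        simpa using h
      · intro i j h
        simpa using h
      · rw [Set.disjoint_left]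
        rintro _ ⟨i, -, rfl⟩ ⟨j, -, h⟩
        cases h
    rw [hatt, degree, add_comm]
  · rw [Scaffold.ncard_neighborSet_inr]
    rcases w with ⟨v, y⟩ | p
    · have h : {w | C.scaffold.link (.inl (v, y)) w} =
          (fun y' => Sum.inl (v + gen none, y')) '' L.graph.neighborSet y := by
        ext (⟨v', y'⟩ | p)
        · simp [link_inl, eq_comm, and_comm]
        · simp [scaffold]
      rw [h, Set.ncard_image_of_injective, card_nbr_inl]
      · have := C.large.deg_lt L y
        change degree k t - L.deg y + L.deg y = degree k t
        omega
      · intro i j h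
        simpa using h
    · have h : {w | C.scaffold.link (.inr p) w} = ∅ := by
        ext (p' | p') <;> simp [scaffold]
      rw [h, nbr_inr, C.card_pad, Set.ncard_empty, add_zero]

/-! #### Endomorphisms fix the core and the pads -/

variable (f : C.G →g C.G)

/-- Vertices of the copies of the pattern are mapped to such vertices: pads are not adjacent to
attached vertices. -/
lemma exists_copy_eq (v : Cube k) (y : Y) :
    ∃ v' y', f (.inr (.inl (v, y))) = .inr (.inl (v', y')) := by
  have := L.finite_fibre C.large
  have := L.nonempty_fibre C.large
  obtain ⟨y₁, hy₁⟩ := L.exists_adj y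
  obtain ⟨w, hw⟩ := Scaffold.exists_attached_eq f (C.lt_card_nbr (.inl (v, y)))
  obtain ⟨w₁, hw₁⟩ := Scaffold.exists_attached_eq f (C.lt_card_nbr (.inl (v + gen none, y₁)))
  have hadj : C.G.Adj (.inr (.inl (v, y))) (.inr (.inl (v + gen none, y₁))) := ⟨rfl, hy₁⟩
  have := f.map_adj hadj
  rw [hw, hw₁, Scaffold.adj_inr_inr] at this
  rcases w with ⟨v', y'⟩ | p
  · exact ⟨v', y', hw⟩
  · rcases w₁ with p' | p' <;> exact this.elim

/-- The neighbourhood of a leaf is mapped onto the neighbourhood of its image. -/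
lemma image_ptNbr_of_deg_eq_one {v v' : Cube k} {y y' : Y} (hy : L.deg y = 1)
    (hf : f (.inr (.inl (v, y))) = .inr (.inl (v', y'))) :
    (fun x => Scaffold.coreMap f (v, .inl x)) '' (L.ptNbr t v y : Set (L.Pt k t)) =
      (fun x => (v', Sum.inl x)) '' (L.ptNbr t v' y' : Set (L.Pt k t)) := by
  have := L.finite_fibre C.large
  have := L.nonempty_fibre C.large
  apply Set.eq_of_subset_of_ncard_le
  · rintro _ ⟨x, hx, rfl⟩
    obtain ⟨h1, h2⟩ := Scaffold.coreMap_of_mem_nbr f hf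
      (x := .inl x) (by rw [nbr_inl]; simpa using hx)
    rw [nbr_inl, Finset.mem_map] at h2
    obtain ⟨x', hx', h2⟩ := h2
    exact ⟨x', hx', Prod.ext h1.symm h2⟩
  · rw [Set.ncard_image_of_injective, Set.ncard_image_of_injective, Set.ncard_coe_finset,
      Set.ncard_coe_finset, card_ptNbr, card_ptNbr, hy]
    · have := L.one_le_deg y'
      omega
    · intro x x' h
      have := Scaffold.coreMap_injective f h
      simpa using this
    · intro x x' h
      simpa using h
  · exact Set.toFinite _

/-- The leaves `a` and `b` of a copy are mapped to the leaves of the same copy, because the number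
of their common neighbours tells the copies apart. -/
lemma image_ptNbr_inter (v : Cube k) :
    (fun x => Scaffold.coreMap f (v, .inl x)) ''
        ((L.ptNbr t v L.a ∩ L.ptNbr t v L.b : Finset _) : Set (L.Pt k t)) =
      (fun x => (v, Sum.inl x)) ''
        ((L.ptNbr t v L.a ∩ L.ptNbr t v L.b : Finset _) : Set (L.Pt k t)) := by
  have := L.finite_fibre C.large
  have := L.nonempty_fibre C.large
  obtain ⟨v₁, y₁, h₁⟩ := C.exists_copy_eq f v L.a
  obtain ⟨v₂, y₂, h₂⟩ := C.exists_copy_eq f v L.b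
  have i₁ := C.image_ptNbr_of_deg_eq_one f L.deg_a h₁
  have i₂ := C.image_ptNbr_of_deg_eq_one f L.deg_b h₂
  have hinj : Function.Injective fun x : L.Pt k t => Scaffold.coreMap f (v, .inl x) := by
    intro x x' h
    have := Scaffold.coreMap_injective f h
    simpa using this
  have hinj' : ∀ u : Cube k, Function.Injective
      fun x : L.Pt k t => ((u, Sum.inl x) : Cube k × L.Fibre k t) := by
    intro u x x' h
    simpa using h
  have hne : (L.ptNbr t v L.a ∩ L.ptNbr t v L.b).Nonempty := by
    rw [← Finset.card_pos, C.large.card_ptNbr_inter]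
    exact one_le_code v
  have hv : v₁ = v₂ := by
    obtain ⟨x, hx⟩ := hne
    rw [Finset.mem_inter] at hx
    have m₁ := i₁.le ⟨x, hx.1, rfl⟩
    have m₂ := i₂.le ⟨x, hx.2, rfl⟩
    obtain ⟨x₁, -, e₁⟩ := m₁
    obtain ⟨x₂, -, e₂⟩ := m₂
    exact congrArg Prod.fst (e₁.trans e₂.symm)
  subst hv
  have hint : (fun x => Scaffold.coreMap f (v, .inl x)) ''
        ((L.ptNbr t v L.a ∩ L.ptNbr t v L.b : Finset _) : Set (L.Pt k t)) =
      (fun x => (v₁, Sum.inl x)) ''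
        ((L.ptNbr t v₁ y₁ ∩ L.ptNbr t v₁ y₂ : Finset _) : Set (L.Pt k t)) := by
    rw [Finset.coe_inter, Finset.coe_inter, Set.image_inter hinj, Set.image_inter (hinj' v₁), i₁, i₂]
  have hcard : code v = (L.ptNbr t v₁ y₁ ∩ L.ptNbr t v₁ y₂).card := by
    rw [← C.large.card_ptNbr_inter v, ← Set.ncard_coe_finset, ← Set.ncard_coe_finset,
      ← Set.ncard_image_of_injective _ hinj, hint, Set.ncard_image_of_injective _ (hinj' v₁)]
  have hdiff : L.ptNbr t v₁ y₁ ≠ L.ptNbr t v₁ y₂ := by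
    intro h
    rw [h, ← i₂] at i₁
    have h3 := hinj.image_injective i₁
    rw [Finset.coe_inj] at h3
    have h4 := C.large.lab_eq_of_subset (v := v) (y := L.a) (y' := L.b) h3.le
    rw [lab_a, lab_b] at h4
    exact L.a_ne_b h4
  have hpair := eq_of_ptNbr_inter hdiff (by
    rw [← Finset.card_pos, ← hcard]
    exact one_le_code v)
  have hint' : L.ptNbr t v₁ y₁ ∩ L.ptNbr t v₁ y₂ = L.ptNbr t v₁ L.a ∩ L.ptNbr t v₁ L.b := by
    rcases hpair with ⟨rfl, rfl⟩ | ⟨rfl, rfl⟩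
    · rfl
    · exact Finset.inter_comm _ _
  rw [hint', C.large.card_ptNbr_inter] at hcard
  obtain rfl : v = v₁ := code_injective hcard
  rw [hint, hint']

/-- Endomorphisms fix the core. -/
lemma coreMap_eq (q : Cube k × L.Fibre k t) : Scaffold.coreMap f q = q := by
  have := L.finite_fibre C.large
  have := L.nonempty_fibre C.large
  have hne : ∀ v : Cube k, (L.ptNbr t v L.a ∩ L.ptNbr t v L.b).Nonempty := by
    intro v
    rw [← Finset.card_pos, C.large.card_ptNbr_inter]
    exact one_le_code v
  have hfib : ∀ q, (Scaffold.coreMap f q).1 = q.1 := by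
    refine Scaffold.coreMap_fst_eq f C.lt_card_nbr ?_ ?_
    · intro v T hT h
      exact C.pad_conn v T hT fun i => h (.inr (v, i)) rfl
    · intro v
      obtain ⟨x, hx⟩ := hne v
      obtain ⟨x', -, h⟩ := (C.image_ptNbr_inter f v).le ⟨x, hx, rfl⟩
      exact ⟨.inl x, (congrArg Prod.fst h).symm⟩
  -- over the vertex of code `1` the two leaves have a single common neighbour, so it is fixed
  obtain ⟨v, hv⟩ := exists_code_eq_one k
  obtain ⟨x, hx⟩ := hne v
  obtain ⟨x', hx', h⟩ := (C.image_ptNbr_inter f v).le ⟨x, hx, rfl⟩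
  have hxx : x' = x := by
    have h1 := C.large.card_ptNbr_inter (L := L) v
    rw [hv, Finset.card_eq_one] at h1
    obtain ⟨z, hz⟩ := h1
    rw [hz] at hx
    simp only [hz, Finset.coe_singleton, Set.mem_singleton_iff] at hx'
    rw [hx', Finset.mem_singleton.1 hx]
  subst hxx
  exact Scaffold.coreMap_eq_self f hfib h.symm q

lemma map_core (q : Cube k × L.Fibre k t) : f (.inl q) = .inl q := by
  rw [Scaffold.map_inl, coreMap_eq]

/-- Once the core is fixed, the neighbourhood of the image of an attached vertex contains the
neighbourhood of the vertex. -/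
lemma nbr_subset {w w' : L.Att k t} (h : f (.inr w) = .inr w') :
    C.scaffold.pos w = C.scaffold.pos w' ∧ C.scaffold.nbr w ⊆ C.scaffold.nbr w' := by
  have key : ∀ x ∈ C.scaffold.nbr w, C.scaffold.pos w = C.scaffold.pos w' ∧
      x ∈ C.scaffold.nbr w' := by
    intro x hx
    have := Scaffold.coreMap_of_mem_nbr f h hx
    rwa [coreMap_eq] at this
  have hne : (C.scaffold.nbr w).Nonempty := by
    rw [← Finset.card_pos]
    exact (Nat.zero_le _).trans_lt (C.lt_card_nbr w)
  obtain ⟨x, hx⟩ := hne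
  exact ⟨(key x hx).1, fun x hx => (key x hx).2⟩

/-- Endomorphisms fix the pads. -/
lemma map_pad (p : Cube k × ZMod (L.padCount k t)) : f (.inr (.inr p)) = .inr (.inr p) := by
  have := L.finite_fibre C.large
  have := L.nonempty_fibre C.large
  obtain ⟨w, hw⟩ := Scaffold.exists_attached_eq f (C.lt_card_nbr (.inr p))
  obtain ⟨h1, h2⟩ := C.nbr_subset f hw
  obtain ⟨v, i⟩ := p
  rcases w with ⟨v', y⟩ | ⟨v', i'⟩
  · have h3 := Finset.card_le_card h2
    rw [card_nbr_inl, nbr_inr, C.card_pad] at h3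
    have := L.one_le_deg y
    have := C.large.deg_lt L y
    simp only at h3
    omega
  · obtain rfl : v = v' := h1
    have h3 : C.pad v i = C.pad v i' := Finset.eq_of_subset_of_card_le h2 (by
      rw [C.card_pad, C.card_pad])
    rw [hw, C.pad_injective v h3]

/-- Endomorphisms preserve the blocks of the vertices of the copies of the pattern. -/
lemma exists_map_copy (v : Cube k) (y : Y) :
    ∃ y', f (.inr (.inl (v, y))) = .inr (.inl (v, y')) ∧ L.lab v y' = L.lab v y := by
  obtain ⟨v', y', h⟩ := C.exists_copy_eq f v y
  obtain ⟨h1, h2⟩ := C.nbr_subset f h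
  obtain rfl : v = v' := h1
  refine ⟨y', h, (C.large.lab_eq_of_subset (v := v) ?_).symm⟩
  rw [nbr_inl, nbr_inl] at h2
  exact Finset.map_subset_map.1 h2

/-! #### The endomorphism monoid -/

lemma ptNbr_moved (φ : L.labelEnd) (v : Cube k) (y : Y) :
    L.ptNbr t v (moved φ v y) = L.ptNbr t v y := by
  refine ptNbr_congr ?_ (lab_moved φ v y)
  rw [← lab_eq_b (v := v), lab_moved, lab_eq_b]

/-- The endomorphism of the regular graph induced by a label-preserving endomorphism of the
pattern. -/
noncomputable def extend (φ : L.labelEnd) : C.G →g C.G where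
  toFun
    | .inl q => .inl q
    | .inr (.inl (v, y)) => .inr (.inl (v, moved φ v y))
    | .inr (.inr p) => .inr (.inr p)
  map_rel' := by
    have hnbr : ∀ q v y, C.G.Adj (.inl q) (.inr (.inl (v, y))) →
        C.G.Adj (.inl q) (.inr (.inl (v, moved φ v y))) := by
      rintro q v y ⟨h1, h2⟩
      refine ⟨h1, ?_⟩
      rw [nbr_inl] at h2 ⊢
      simpa only [ptNbr_moved] using h2
    rintro (q | ⟨v, y⟩ | p) (q' | ⟨v', y'⟩ | p') h
    · exact h
    · exact hnbr _ _ _ h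
    · exact h
    · exact (hnbr _ _ _ h.symm).symm
    · obtain ⟨rfl, h⟩ : v' = v + gen none ∧ L.graph.Adj y y' := h
      refine ⟨rfl, ?_⟩
      simp only [moved, copy_eq_of_adj h]
      split_ifs
      · exact φ.1.map_adj h
      · exact h
    · exact h
    · exact h
    · exact h
    · exact h

lemma extend_inl (φ : L.labelEnd) (q : Cube k × L.Fibre k t) : C.extend φ (.inl q) = .inl q := rfl

lemma extend_copy (φ : L.labelEnd) (v : Cube k) (y : Y) :
    C.extend φ (.inr (.inl (v, y))) = .inr (.inl (v, moved φ v y)) := rfl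

lemma extend_pad (φ : L.labelEnd) (p : Cube k × ZMod (L.padCount k t)) :
    C.extend φ (.inr (.inr p)) = .inr (.inr p) := rfl

lemma extend_mul (φ ψ : L.labelEnd) : C.extend (φ * ψ) = C.extend φ * C.extend ψ := by
  apply RelHom.ext
  rintro (q | ⟨v, y⟩ | p)
  · rfl
  · rw [RelHom.mul_apply, extend_copy, extend_copy, extend_copy]
    congr 3
    by_cases h : L.copy v y = 0
    · simp [moved, h, copy_map, RelHom.mul_apply]
    · simp [moved, h]
  · rfl

lemma extend_one : C.extend 1 = 1 := by
  apply RelHom.ext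
  rintro (q | ⟨v, y⟩ | p)
  · rfl
  · rw [extend_copy]
    simp [moved]
  · rfl

lemma extend_injective : Function.Injective C.extend := by
  intro φ ψ h
  apply Subtype.ext
  apply RelHom.ext
  intro y
  have h1 := congrArg (fun f : C.G →g C.G => f (.inr (.inl (base L k y, y)))) h
  simpa [extend_copy, moved, copy_base] using h1

lemma extend_surjective : Function.Surjective C.extend := by
  intro f
  choose m hm hlab using C.exists_map_copy f
  have hrep : ∀ v y, L.rep (m v y) = L.rep y := fun v y => rep_eq_of_lab_eq (hlab v y)
  have hbase : ∀ {y y'}, L.graph.Adj y y' → base L k y' = base L k y + gen none := by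
    intro y y' h
    have := L.side_ne h
    unfold base
    cases h1 : L.side y <;> cases h2 : L.side y' <;> simp_all [cube_add_self]
  let φ : L.graph →g L.graph := ⟨fun y => m (base L k y) y, by
    intro y y' h
    have hadj : C.G.Adj (.inr (.inl (base L k y, y))) (.inr (.inl (base L k y', y'))) :=
      ⟨hbase h, h⟩
    have := f.map_adj hadj
    rw [hm, hm, Scaffold.adj_inr_inr, link_inl] at this
    exact this.2⟩
  refine ⟨⟨φ, fun y => hrep _ y⟩, ?_⟩
  apply RelHom.ext
  rintro (q | ⟨v, y⟩ | p)
  · rw [extend_inl, C.map_core f]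
  · rw [extend_copy, hm]
    congr 3
    unfold moved
    split_ifs with h
    · have : base L k y = v := by
        unfold copy at h
        unfold base
        split_ifs at h ⊢
        · exact (eq_of_cube_add_eq_zero h).symm
        · exact h.symm
      change m (base L k y) y = m v y
      rw [this]
    · exact eq_of_lab_eq h (hlab v y).symm
  · rw [extend_pad, C.map_pad f]

/-- The endomorphism monoid of the regular graph is the monoid of label-preserving endomorphisms of
the pattern. -/
noncomputable def endEquiv : (C.G →g C.G) ≃* L.labelEnd :=
  (MulEquiv.ofBijective (⟨⟨C.extend, C.extend_one⟩, C.extend_mul⟩ : L.labelEnd →* (C.G →g C.G))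
    ⟨C.extend_injective, C.extend_surjective⟩).symm

end Choices

end Pattern

/-! ### The pattern of a monoid -/

namespace MonoidPattern

variable {M : Type} [Monoid M]

/-- A triple `(x, y, c)` is good if right multiplication by `c` maps `x` to `y`. -/
def Good (p : M × M × M) : Prop := p.1 * p.2.2 = p.2.1

/-- Left translation of the first two entries of a triple. -/
def shift (m : M) (p : M × M × M) : M × M × M := (m * p.1, m * p.2.1, p.2.2)

lemma Good.shift {p : M × M × M} (h : Good p) (m : M) : Good (shift m p) := by
  unfold Good at h ⊢
  simp only [MonoidPattern.shift, mul_assoc, h]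

variable (M) in
/-- The vertices of the pattern of a monoid. There are two copies `s` and `t` of the monoid, and a
triple `p = (x, y, c)` is represented by a vertex `β p` next to `s x` and `t y`, a vertex `γ p` and,
if the triple is not good, two further vertices `β' p` and `γ' p` which a homomorphism may fold onto
`β p` and `γ p` only when `p` becomes good. -/
inductive Vert
  | s (x : M)
  | t (y : M)
  | β (p : M × M × M)
  | β' (p : {p : M × M × M // ¬ Good p})
  | γ (p : M × M × M)
  | γ' (p : {p : M × M × M // ¬ Good p})
  | c
  | z₀
  | z₁
  | a
  | b

open Vert

instance [Finite M] : Finite (Vert M) := by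
  have h : Function.Surjective (Sum.elim s (Sum.elim t (Sum.elim β (Sum.elim β' (Sum.elim γ
      (Sum.elim γ' (![c, z₀, z₁, a, b] : Fin 5 → Vert M))))))) := by
    rintro (x | y | p | p | p | p | _ | _ | _ | _ | _)
    · exact ⟨.inl x, rfl⟩
    · exact ⟨.inr (.inl y), rfl⟩
    · exact ⟨.inr (.inr (.inl p)), rfl⟩
    · exact ⟨.inr (.inr (.inr (.inl p))), rfl⟩
    · exact ⟨.inr (.inr (.inr (.inr (.inl p)))), rfl⟩
    · exact ⟨.inr (.inr (.inr (.inr (.inr (.inl p))))), rfl⟩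
    · exact ⟨.inr (.inr (.inr (.inr (.inr (.inr 0))))), rfl⟩
    · exact ⟨.inr (.inr (.inr (.inr (.inr (.inr 1))))), rfl⟩
    · exact ⟨.inr (.inr (.inr (.inr (.inr (.inr 2))))), rfl⟩
    · exact ⟨.inr (.inr (.inr (.inr (.inr (.inr 3))))), rfl⟩
    · exact ⟨.inr (.inr (.inr (.inr (.inr (.inr 4))))), rfl⟩
  exact Finite.of_surjective _ h

/-- The side of a vertex. -/
def side : Vert M → Bool
  | β _ | β' _ | z₀ | z₁ => true
  | _ => false

/-- The edges, directed from the side `true` to the side `false`. -/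
def Edge : Vert M → Vert M → Prop
  | β p, s x => p.1 = x
  | β p, t y => p.2.1 = y
  | β p, c => Good p
  | β p, γ q => p = q
  | β p, γ' q => p = q.1
  | β' p, s x => p.1.1 = x
  | β' _, c => True
  | β' p, γ q => p.1 = q
  | β' p, γ' q => p = q
  | z₀, γ q => Good q
  | z₀, γ' _ => True
  | z₀, a => True
  | z₀, b => True
  | z₁, γ _ => True
  | _, _ => False

lemma Edge.side {u v : Vert M} (h : Edge u v) : side u = true ∧ side v = false := by
  cases u <;> cases v <;> simp [Edge, MonoidPattern.side] at h ⊢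

variable (M) in
/-- The graph of the pattern. -/
def graph : SimpleGraph (Vert M) where
  Adj u v := Edge u v ∨ Edge v u
  symm := ⟨fun _ _ => Or.symm⟩
  loopless := ⟨by
    intro u h
    rcases h with h | h <;> simpa [h.side.1] using h.side.2⟩

lemma adj_of_edge {u v : Vert M} (h : Edge u v) : (graph M).Adj u v := Or.inl h

lemma adj_of_edge' {u v : Vert M} (h : Edge u v) : (graph M).Adj v u := Or.inr h

lemma adj_iff_of_side {u v : Vert M} (h : side u = true) : (graph M).Adj u v ↔ Edge u v :=
  or_iff_left fun h' => by simpa [h] using h'.side.2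

/-- The label of a vertex. -/
def rep : Vert M → Vert M
  | s _ => s 1
  | t _ => t 1
  | β p => β (1, 1, p.2.2)
  | β' p => β (1, 1, p.1.2.2)
  | γ _ => γ 1
  | γ' _ => γ 1
  | u => u

/-! #### Degrees -/

lemma ncard_neighborSet_of_side {u : Vert M} (h : side u = true) {S : Set (Vert M)}
    (hS : ∀ v, Edge u v ↔ v ∈ S) : ((graph M).neighborSet u).ncard = S.ncard := by
  congr 1
  ext v
  rw [mem_neighborSet, adj_iff_of_side h, hS]

lemma ncard_neighborSet_of_side' {u : Vert M} (h : side u = false) {S : Set (Vert M)}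
    (hS : ∀ v, Edge v u ↔ v ∈ S) : ((graph M).neighborSet u).ncard = S.ncard := by
  congr 1
  ext v
  rw [mem_neighborSet, ← hS]
  exact or_iff_right fun h' => by simpa [h] using h'.side.1

lemma ncard_neighborSet_beta (p : M × M × M) : ((graph M).neighborSet (β p)).ncard = 4 := by
  by_cases hp : Good p
  · rw [ncard_neighborSet_of_side rfl (S := {s p.1, t p.2.1, γ p, c})]
    · rw [Set.ncard_insert_of_notMem, Set.ncard_insert_of_notMem, Set.ncard_pair] <;> simp
    · rintro (_ | _ | _ | _ | _ | ⟨q, hq⟩ | _ | _ | _ | _ | _) <;>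
        simp [Edge, hp, eq_comm]
      rintro rfl
      exact hq hp
  · rw [ncard_neighborSet_of_side rfl (S := {s p.1, t p.2.1, γ p, γ' ⟨p, hp⟩})]
    · rw [Set.ncard_insert_of_notMem, Set.ncard_insert_of_notMem, Set.ncard_pair] <;> simp
    · rintro (_ | _ | _ | _ | _ | ⟨q, hq⟩ | _ | _ | _ | _ | _) <;>
        simp [Edge, hp, eq_comm]

lemma ncard_neighborSet_beta' (p : {p : M × M × M // ¬ Good p}) :
    ((graph M).neighborSet (β' p)).ncard = 4 := by
  rw [ncard_neighborSet_of_side rfl (S := {s p.1.1, c, γ p, γ' p})]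
  · rw [Set.ncard_insert_of_notMem, Set.ncard_insert_of_notMem, Set.ncard_pair] <;> simp
  · rintro (_ | _ | _ | _ | _ | ⟨q, hq⟩ | _ | _ | _ | _ | _) <;>
      simp [Edge, eq_comm]

lemma ncard_neighborSet_gamma (p : M × M × M) : ((graph M).neighborSet (γ p)).ncard = 3 := by
  by_cases hp : Good p
  · rw [ncard_neighborSet_of_side' rfl (S := {β p, z₁, z₀})]
    · rw [Set.ncard_insert_of_notMem, Set.ncard_pair] <;> simp
    · rintro (_ | _ | _ | ⟨q, hq⟩ | _ | _ | _ | _ | _ | _ | _) <;>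
        simp [Edge, hp]
      rintro rfl
      exact hq hp
  · rw [ncard_neighborSet_of_side' rfl (S := {β p, z₁, β' ⟨p, hp⟩})]
    · rw [Set.ncard_insert_of_notMem, Set.ncard_pair] <;> simp
    · rintro (_ | _ | _ | ⟨q, hq⟩ | _ | _ | _ | _ | _ | _ | _) <;>
        simp [Edge, hp]

lemma ncard_neighborSet_gamma' (p : {p : M × M × M // ¬ Good p}) :
    ((graph M).neighborSet (γ' p)).ncard = 3 := by
  rw [ncard_neighborSet_of_side' rfl (S := {β p, β' p, z₀})]
  · rw [Set.ncard_insert_of_notMem, Set.ncard_pair] <;> simp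
  · rintro (_ | _ | _ | ⟨q, hq⟩ | _ | _ | _ | _ | _ | _ | _) <;>
      simp [Edge]

lemma ncard_neighborSet_t (y : M) : ((graph M).neighborSet (t y)).ncard = Nat.card (M × M) := by
  rw [ncard_neighborSet_of_side' rfl (S := Set.range fun q : M × M => β (q.1, y, q.2))]
  · rw [← Set.image_univ, Set.ncard_image_of_injective, Set.ncard_univ]
    intro q q' h
    simpa [Prod.ext_iff] using h
  · rintro (_ | _ | ⟨x, y', d⟩ | _ | _ | _ | _ | _ | _ | _ | _) <;> simp [Edge, eq_comm]

lemma ncard_neighborSet_s [Finite M] (x : M) : ((graph M).neighborSet (s x)).ncard =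
    Nat.card (M × M) + (Nat.card (M × M) - Nat.card M) := by
  have hc : {q : M × M | ¬ Good (x, q)}.ncard = Nat.card (M × M) - Nat.card M := by
    have h : {q : M × M | ¬ Good (x, q)}ᶜ = Set.range fun d => (x * d, d) := by
      ext ⟨y, d⟩
      simp [Good]
    rw [← compl_compl {q : M × M | ¬ Good (x, q)}, Set.ncard_compl, h, ← Set.image_univ,
      Set.ncard_image_of_injective, Set.ncard_univ]
    intro d d' h
    exact congrArg Prod.snd h
  have hc' : {u : Vert M | ∃ p, u = β' p ∧ p.1.1 = x}.ncard = {q : M × M | ¬ Good (x, q)}.ncard := by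
    symm
    apply Set.ncard_congr fun q hq => β' ⟨(x, q), hq⟩
    · intro q hq
      exact ⟨_, rfl, rfl⟩
    · intro q q' hq hq' h
      simpa using h
    · rintro _ ⟨⟨⟨x', q⟩, hq⟩, rfl, rfl⟩
      exact ⟨q, hq, rfl⟩
  rw [ncard_neighborSet_of_side' rfl (S := (Set.range fun q : M × M => β (x, q)) ∪
    {u : Vert M | ∃ p, u = β' p ∧ p.1.1 = x})]
  · rw [Set.ncard_union_eq, hc', hc, ← Set.image_univ, Set.ncard_image_of_injective, Set.ncard_univ]
    · intro q q' h
      simpa using h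
    · rw [Set.disjoint_left]
      rintro _ ⟨q, rfl⟩ ⟨p, h, -⟩
      cases h
  · rintro (_ | _ | ⟨x', y', d⟩ | ⟨⟨x', y', d⟩, h⟩ | _ | _ | _ | _ | _ | _ | _) <;>
      simp [Edge, eq_comm]
    rintro rfl
    exact h

variable (M) in
/-- The pattern of a finite monoid. -/
def pattern [Finite M] : Pattern (Vert M) where
  graph := graph M
  side := side
  side_ne := by
    rintro u v (h | h) <;> simp [h.side.1, h.side.2]
  rep := rep
  side_rep := by rintro (_ | _) <;> rfl
  deg_eq := by
    intro u v h
    cases u <;> cases v <;> simp [rep] at h <;>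
      simp only [ncard_neighborSet_s, ncard_neighborSet_t, ncard_neighborSet_beta,
        ncard_neighborSet_beta', ncard_neighborSet_gamma, ncard_neighborSet_gamma']
  exists_adj := by
    rintro (x | y | p | p | p | p | _ | _ | _ | _ | _)
    · exact ⟨β (x, 1, 1), adj_of_edge' rfl⟩
    · exact ⟨β (1, y, 1), adj_of_edge' rfl⟩
    · exact ⟨s p.1, adj_of_edge rfl⟩
    · exact ⟨s p.1.1, adj_of_edge rfl⟩
    · exact ⟨β p, adj_of_edge' rfl⟩
    · exact ⟨β p, adj_of_edge' rfl⟩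
    · exact ⟨β (1, 1, 1), adj_of_edge' (mul_one 1)⟩
    · exact ⟨a, adj_of_edge trivial⟩
    · exact ⟨γ 1, adj_of_edge trivial⟩
    · exact ⟨z₀, adj_of_edge' trivial⟩
    · exact ⟨z₀, adj_of_edge' trivial⟩
  a := a
  b := b
  a_ne_b := by simp
  rep_eq_a := by rintro (_ | _) <;> simp [rep]
  rep_eq_b := by rintro (_ | _) <;> simp [rep]
  deg_a := by
    rw [ncard_neighborSet_of_side' rfl (S := {z₀}), Set.ncard_singleton]
    rintro (_ | _) <;> simp [Edge]
  deg_b := by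
    rw [ncard_neighborSet_of_side' rfl (S := {z₀}), Set.ncard_singleton]
    rintro (_ | _) <;> simp [Edge]

/-! #### Label-preserving endomorphisms -/

open Classical in
/-- The action of a monoid element on the pattern by left multiplication. -/
noncomputable def act (m : M) : Vert M → Vert M
  | s x => s (m * x)
  | t y => t (m * y)
  | β p => β (shift m p)
  | β' p => if h : Good (shift m p.1) then β (shift m p) else β' ⟨_, h⟩
  | γ p => γ (shift m p)
  | γ' p => if h : Good (shift m p.1) then γ (shift m p) else γ' ⟨_, h⟩
  | u => u

lemma edge_act (m : M) {u v : Vert M} (h : Edge u v) : Edge (act m u) (act m v) := by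
  have hm : ∀ p : M × M × M, Good p → Good (shift m p) := fun p h => h.shift m
  rcases u with x | y | p | ⟨p, hp⟩ | p | ⟨p, hp⟩ | _ | _ | _ | _ | _ <;>
    rcases v with x' | y' | p' | ⟨p', hp'⟩ | p' | ⟨p', hp'⟩ | _ | _ | _ | _ | _ <;>
    simp only [Edge, Subtype.mk.injEq] at h <;> (try subst h) <;> simp only [act] <;>
    (try split_ifs) <;> simp_all [Edge, shift]

lemma rep_act (m : M) (u : Vert M) : rep (act m u) = rep u := by
  cases u <;> simp only [act] <;> (try split_ifs) <;> simp [rep, shift]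

variable [Finite M]

/-- Left multiplication as a label-preserving endomorphism. -/
noncomputable def actHom (m : M) : (pattern M).labelEnd :=
  ⟨⟨act m, fun h => h.imp (edge_act m) (edge_act m)⟩, rep_act m⟩

lemma actHom_apply (m : M) (u : Vert M) : (actHom m).1 u = act m u := rfl

/-- Every label-preserving endomorphism is a left multiplication: the vertices `β (x, y, d)` make its
action on `s` commute with right multiplication by `d`, and the neighbours determine the rest. -/
lemma exists_eq_actHom (φ : (pattern M).labelEnd) : ∃ m, actHom m = φ := by
  have hrep : ∀ u, rep (φ.1 u) = rep u := φ.2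
  have hadj : ∀ {u v}, Edge u v → Edge (φ.1 u) (φ.1 v) := by
    intro u v h
    have h1 : (graph M).Adj (φ.1 u) (φ.1 v) := φ.1.map_adj (adj_of_edge h)
    refine (adj_iff_of_side ?_).1 h1
    rw [← h.side.1]
    exact (pattern M).side_eq_of_rep_eq (hrep u)
  have hs : ∀ x, ∃ x', φ.1 (s x) = s x' := by
    intro x
    have := hrep (s x)
    generalize φ.1 (s x) = u at this
    cases u <;> simp_all [rep]
  have ht : ∀ y, ∃ y', φ.1 (t y) = t y' := by
    intro y
    have := hrep (t y)
    generalize φ.1 (t y) = u at this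
    cases u <;> simp_all [rep]
  have hc : φ.1 c = c := by
    have := hrep c
    generalize φ.1 c = u at this
    cases u <;> simp_all [rep]
  have hz₀ : φ.1 z₀ = z₀ := by
    have := hrep z₀
    generalize φ.1 z₀ = u at this
    cases u <;> simp_all [rep]
  have hz₁ : φ.1 z₁ = z₁ := by
    have := hrep z₁
    generalize φ.1 z₁ = u at this
    cases u <;> simp_all [rep]
  have ha : φ.1 a = a := (pattern M).rep_eq_a.1 (hrep a)
  have hb : φ.1 b = b := (pattern M).rep_eq_b.1 (hrep b)
  choose f hf using hs
  choose f' hf' using ht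
  have hβ : ∀ p : M × M × M, φ.1 (β p) = β (f p.1, f' p.2.1, p.2.2) := by
    intro p
    have h1 := hrep (β p)
    have h2 := hadj (u := β p) (v := s p.1) rfl
    have h3 := hadj (u := β p) (v := t p.2.1) rfl
    rw [hf] at h2
    rw [hf'] at h3
    generalize φ.1 (β p) = u at h1 h2 h3
    rcases u with _ | _ | ⟨x, y, d⟩ | _ | _ | _ | _ | _ | _ | _ | _ <;> simp_all [rep, Edge]
  -- adjacency to `c` shows that good triples remain good
  have hmul : ∀ x d, f' (x * d) = f x * d := by
    intro x d
    have h := hadj (u := β (x, x * d, d)) (v := c) rfl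
    rw [hβ, hc] at h
    exact Eq.symm h
  have hff : ∀ x, f' x = f x := by
    intro x
    simpa using hmul x 1
  have hfm : ∀ x, f x = f 1 * x := by
    intro x
    rw [← hmul, one_mul, hff]
  set m := f 1 with hm
  replace hβ : ∀ p, φ.1 (β p) = β (shift m p) := by
    intro p
    rw [hβ, hff, hfm p.1, hfm p.2.1, shift]
  have hγ : ∀ p : M × M × M, φ.1 (γ p) = γ (shift m p) := by
    intro p
    have h1 := hrep (γ p)
    have h2 := hadj (u := β p) (v := γ p) rfl
    have h3 := hadj (u := z₁) (v := γ p) trivial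
    rw [hβ] at h2
    rw [hz₁] at h3
    generalize φ.1 (γ p) = u at h1 h2 h3
    cases u <;> simp only [rep, Edge, reduceCtorEq] at h1 h2 h3
    rw [h2]
  have hβ' : ∀ p, φ.1 (β' p) = act m (β' p) := by
    intro p
    have h1 := hrep (β' p)
    have h2 := hadj (u := β' p) (v := c) trivial
    have h3 := hadj (u := β' p) (v := γ p) rfl
    rw [hc] at h2
    rw [hγ] at h3
    generalize φ.1 (β' p) = u at h1 h2 h3
    rcases u with _ | _ | _ | ⟨q, hq⟩ | _ | _ | _ | _ | _ | _ | _ <;>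
      simp only [rep, Edge, act, reduceCtorEq] at h1 h2 h3 ⊢
    · subst h3
      rw [dif_pos h2]
    · subst h3
      rw [dif_neg hq]
  have hγ' : ∀ p, φ.1 (γ' p) = act m (γ' p) := by
    intro p
    have h1 := hrep (γ' p)
    have h2 := hadj (u := β p) (v := γ' p) rfl
    have h3 := hadj (u := z₀) (v := γ' p) trivial
    rw [hβ] at h2
    rw [hz₀] at h3
    generalize φ.1 (γ' p) = u at h1 h2 h3
    rcases u with _ | _ | _ | _ | _ | ⟨q, hq⟩ | _ | _ | _ | _ | _ <;>
      simp only [rep, Edge, act, reduceCtorEq] at h1 h2 h3 ⊢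
    · subst h2
      rw [dif_pos h3]
    · subst h2
      rw [dif_neg hq]
  refine ⟨m, Subtype.ext (RelHom.ext fun u => Eq.symm ?_)⟩
  rw [actHom_apply]
  cases u with
  | s x => rw [hf, hfm, act]
  | t y => rw [hf', hff, hfm, act]
  | β p => exact hβ p
  | β' p => exact hβ' p
  | γ p => exact hγ p
  | γ' p => exact hγ' p
  | c => exact hc
  | z₀ => exact hz₀
  | z₁ => exact hz₁
  | a => exact ha
  | b => exact hb

lemma actHom_injective : Function.Injective (actHom (M := M)) := by
  intro m m' h
  have h1 : act m (s 1) = act m' (s 1) := congrArg (fun φ : (pattern M).labelEnd => φ.1 (s 1)) h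
  simpa [act] using h1

/-- A label-preserving endomorphism is determined by the image of `s 1`. -/
lemma eq_actHom {φ : (pattern M).labelEnd} {m : M} (h : φ.1 (s 1) = s m) : φ = actHom m := by
  obtain ⟨m', rfl⟩ := exists_eq_actHom φ
  rw [actHom_apply] at h
  obtain rfl : m' = m := by simpa [act] using h
  rfl

variable (M) in
/-- The label-preserving endomorphisms of the pattern of a monoid form a copy of the monoid. -/
noncomputable def labelEndEquiv : (pattern M).labelEnd ≃* M :=
  (MulEquiv.ofBijective (⟨⟨actHom, (eq_actHom rfl).symm⟩, fun m m' => (eq_actHom (by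
    change act m (act m' (s 1)) = _
    simp [act])).symm⟩ : M →* (pattern M).labelEnd)
    ⟨actHom_injective, exists_eq_actHom⟩).symm

end MonoidPattern

/-! ### Infinitely many graphs -/

lemma isRegular_of_ncard {V : Type*} [Fintype V] {G : SimpleGraph V} {d : ℕ}
    (h : ∀ v, (G.neighborSet v).ncard = d) : G.IsRegular := by
  classical
  refine ⟨d, fun v => ?_⟩
  rw [← h v, ← card_neighborSet_eq_degree, Set.ncard_eq_toFinset_card', Set.toFinset_card]

/-- Graphs that are regular of different degrees are not isomorphic. -/
lemma isEmpty_iso_of_ncard {V W : Type*} [Nonempty V] {G : SimpleGraph V} {H : SimpleGraph W}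
    {d e : ℕ} (hG : ∀ v, (G.neighborSet v).ncard = d) (hH : ∀ w, (H.neighborSet w).ncard = e)
    (hde : d ≠ e) : IsEmpty (G ≃g H) := by
  refine ⟨fun φ => hde ?_⟩
  obtain ⟨v⟩ := ‹Nonempty V›
  rw [← hG v, ← hH (φ v)]
  exact Nat.card_congr (φ.mapNeighborSet v)

namespace Pattern

lemma large_of_le {Y : Type} [Fintype Y] {k t : ℕ} (hk : 3 ≤ k)
    (ht : Fintype.card Y + Fintype.card (Cube k) + 2 ≤ t) : Large Y k t := by
  have h : t ≤ (2 * k + 1) * t := Nat.le_mul_of_pos_left _ (by omega)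
  constructor
  · exact hk
  · omega
  · unfold attDeg
    omega
  · unfold degree attDeg
    omega

lemma degree_injective (k : ℕ) : Function.Injective (degree k) := by
  intro t t' h
  unfold degree attDeg at h
  refine Nat.eq_of_mul_eq_mul_left (show 0 < 2 * k + 1 by omega) ?_
  omega

end Pattern

end MonoidGraph

open MonoidGraph MonoidGraph.Pattern in
/-- There is an infinite family of pairwise non-isomorphic finite regular graphs of odd girth `g`
whose endomorphism monoids (under composition) are isomorphic to `M`. -/
theorem theorem3 (M : Type*) [Monoid M] [Finite M] (g : ℕ) (hg : Odd g) (hg7 : 7 ≤ g) :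
    ∃ (V : ℕ → Type) (_ : ∀ i, Fintype (V i)) (G : ∀ i, SimpleGraph (V i)),
      (∀ i j, i ≠ j → IsEmpty (G i ≃g G j)) ∧
      ∀ i, (G i).IsRegular ∧ (G i).oddGirth = (g : ℕ∞) ∧ Nonempty ((G i →g G i) ≃* M) := by
  classical
  obtain ⟨k, rfl⟩ := hg
  have : Finite (Shrink.{0} M) := Finite.of_equiv _ (equivShrink.{0} M)
  let Y := MonoidPattern.Vert (Shrink.{0} M)
  let L : Pattern Y := MonoidPattern.pattern (Shrink.{0} M)
  let _ : Fintype Y := Fintype.ofFinite Y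
  let t : ℕ → ℕ := fun i => Fintype.card Y + Fintype.card (Cube k) + 2 + i
  have hl : ∀ i, Large Y k (t i) := fun i => large_of_le (by omega) (Nat.le_add_right _ _)
  have C : ∀ i, L.Choices k (t i) := fun i => (L.nonempty_choices (hl i)).some
  have hX : ∀ i, Nonempty (L.Fibre k (t i)) := fun i => L.nonempty_fibre (hl i)
  have hV : ∀ i, Finite ((Cube k × L.Fibre k (t i)) ⊕ L.Att k (t i)) := by
    intro i
    have : NeZero (L.padCount k (t i)) := ⟨(L.padCount_pos (hl i)).ne'⟩
    infer_instance
  refine ⟨_, fun i => Fintype.ofFinite _, fun i => (C i).G, fun i j hij => ?_, fun i => ⟨?_, ?_, ?_⟩⟩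
  · refine isEmpty_iso_of_ncard (C i).ncard_neighborSet (C j).ncard_neighborSet fun h => hij ?_
    exact Nat.add_left_cancel (degree_injective k h)
  · exact @isRegular_of_ncard _ (Fintype.ofFinite _) _ _ (C i).ncard_neighborSet
  · exact (C i).scaffold.oddGirth_graph
  · exact ⟨(C i).endEquiv.trans
      ((MonoidPattern.labelEndEquiv (Shrink.{0} M)).trans (equivShrink.{0} M).symm.mulEquiv)⟩
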